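/- Let $H^1=H^1(\mathbb R)$ be the real-valued Sobolev space with norm $\|f\|_{H^1}=(\|f\|_{L^2}^2+\|f_x\|_{L^2}^2)^{1/2}$, and let $Hf(x)=\frac1\pi\,\mathrm{P.V.}\!\int_{-\infty}^{\infty}\frac{f(y)}{x-y}\,dy$ be the Hilbert transform. Consider, on $\mathbb R$, the nonlocal system $$u_t=2uv,\qquad v_t=H(u^2),\qquad u(\cdot,0)=u_0,\quad v(\cdot,0)=v_0,$$ where solutions on a time interval $I$ are understood as pairs $(u,v)$ with $u,v\in C^1(I;H^1)$. Let $u_0,v_0\in H^1$, and suppose that $u_0$ is supported in a closed interval of length $\delta\ge 0$ and that $v_0\le -3$ on this interval. If $$\delta^{1/2}\Bigl(\|v_{0x}\|_{L^2}+\tfrac13\,\delta^{1/2}\|u_{0x}\|_{L^2}^2\Bigr)<\tfrac14,$$ then the system has a solution $(u,v)$ on $[0,\infty)$; every solution with the same initial data on an interval $[0,T)$, $T>0$, coincides with it on $[0,T)$; and $\|u(t)\|_{H^1}$ and $\|v(t)\|_{H^1}$ remain bounded for all $t\ge0$. Moreover, there is a constant $C$, depending only on $u_0$, $v_0$ and $\delta$,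 such that for all $t\ge 0$ $$\|u(t)\|_{L^\infty}\le Ce^{-3t},\qquad \|u(t)\|_{H^1}\le Ce^{-3t},\qquad \|v(t)\|_{H^1}\le C.$$ -/

import Mathlib

open MeasureTheory Set Filter Topology
open scoped ENNReal ContDiff

namespace NonlocalSystem

/-- `g` is the weak derivative of `f` on the real line:
`∫ f φ' = - ∫ g φ` for every smooth compactly supported `φ`. -/
def IsWeakDeriv (f g : ℝ → ℝ) : Prop :=
  ∀ φ : ℝ → ℝ, ContDiff ℝ ∞ φ → HasCompactSupport φ →
    ∫ x, f x * deriv φ x = -∫ x, g x * φ x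

/-- Real-valued `L²(ℝ)`. -/
abbrev L2 : Type := Lp ℝ 2 (volume : Measure ℝ)

theorem integrable_mul_test (f : L2) {φ : ℝ → ℝ} (hc : Continuous φ)
    (hφ : HasCompactSupport φ) : Integrable (fun x => f x * φ x) :=
  (Lp.memLp f).integrable_mul (q := 2) (hc.memLp_of_hasCompactSupport hφ)

/-- The Sobolev space `H¹(ℝ)`, as the space of pairs `(f, f_x)` of `L²` functions in which `f_x` is
the weak derivative of `f` (so that `f_x` is determined by `f`). The `2`-norm on the product makes
the norm of `f` equal to `(‖f‖_{L²}² + ‖f_x‖_{L²}²)^{1/2}`. -/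
def H1Submodule : Submodule ℝ (WithLp 2 (L2 × L2)) where
  carrier := {p | IsWeakDeriv p.fst p.snd}
  zero_mem' := by
    intro φ hφ hs
    have key : ∀ ψ : ℝ → ℝ, ∫ x, (0 : L2) x * ψ x = 0 := by
      intro ψ
      refine integral_eq_zero_of_ae ?_
      filter_upwards [Lp.coeFn_zero ℝ 2 (volume : Measure ℝ)] with x hx
      rw [hx, Pi.zero_apply, zero_mul]
    change ∫ x, (0 : L2) x * deriv φ x = -∫ x, (0 : L2) x * φ x
    rw [key, key, neg_zero]
  add_mem' := by
    intro p q hp hq φ hφ hs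
    have key : ∀ (f g : L2) {ψ : ℝ → ℝ}, Continuous ψ → HasCompactSupport ψ →
        ∫ x, (f + g : L2) x * ψ x = (∫ x, f x * ψ x) + ∫ x, g x * ψ x := by
      intro f g ψ hc hψ
      rw [← integral_add (integrable_mul_test f hc hψ) (integrable_mul_test g hc hψ)]
      refine integral_congr_ae ?_
      filter_upwards [Lp.coeFn_add f g] with x hx
      rw [hx, Pi.add_apply, add_mul]
    have h1 := key p.fst q.fst (hφ.continuous_deriv (by simp)) hs.deriv
    have h2 := key p.snd q.snd hφ.continuous hs
    change ∫ x, (p.fst + q.fst : L2) x * deriv φ x = -∫ x, (p.snd + q.snd : L2) x * φ x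
    rw [h1, h2, hp φ hφ hs, hq φ hφ hs, neg_add]
  smul_mem' := by
    intro c p hp φ hφ hs
    have key : ∀ (f : L2) (ψ : ℝ → ℝ),
        ∫ x, (c • f : L2) x * ψ x = c * ∫ x, f x * ψ x := by
      intro f ψ
      rw [← integral_const_mul]
      refine integral_congr_ae ?_
      filter_upwards [Lp.coeFn_smul c f] with x hx
      rw [hx, Pi.smul_apply, smul_eq_mul, mul_assoc]
    change ∫ x, (c • p.fst : L2) x * deriv φ x = -∫ x, (c • p.snd : L2) x * φ x
    rw [key, key, hp φ hφ hs, mul_neg]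

/-- The Sobolev space `H¹(ℝ)` with its norm. -/
abbrev H1 : Type := ↥H1Submodule

/-- The `L²` function underlying an element of `H¹`. -/
def H1.fn (f : H1) : L2 := (f : WithLp 2 (L2 × L2)).fst

/-- The weak derivative `f_x`, as an element of `L²`. -/
def H1.dx (f : H1) : L2 := (f : WithLp 2 (L2 × L2)).snd

/-- The Hilbert transform `(H f)(x) = (1/π) P.V. ∫ f(y) / (x - y) dy` exists at `x` and equals `c`. -/
def HasHilbertTransformAt (f : ℝ → ℝ) (x c : ℝ) : Prop :=
  Tendsto (fun ε : ℝ => (1 / Real.pi) * ∫ y in {y : ℝ | ε < |x - y|}, f y / (x - y))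
    (𝓝[>] 0) (𝓝 c)

/-- `(u, v)` is a solution in `C¹(I; H¹)` of `u_t = 2 u v`, `v_t = H(u²)` with initial values
`u₀, v₀`, on a time interval `I` with left end point `0 ∈ I`. At each time the two equations are
identities of functions of `x`, up to null sets. -/
structure IsSolutionOn (I : Set ℝ) (u₀ v₀ : H1) (u v : ℝ → H1) : Prop where
  initial_u : u 0 = u₀
  initial_v : v 0 = v₀
  contDiffOn_u : ContDiffOn ℝ 1 u I
  contDiffOn_v : ContDiffOn ℝ 1 v I
  eqn_u : ∀ t ∈ I, ∀ᵐ x, (derivWithin u I t).fn x = 2 * (u t).fn x * (v t).fn x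
  eqn_v : ∀ t ∈ I, ∀ᵐ x,
    HasHilbertTransformAt (fun y => (u t).fn y ^ 2) x ((derivWithin v I t).fn x)

end NonlocalSystem

namespace NonlocalSystem

/-! ### Square integrable functions on the line -/

/-! The system is an autonomous ODE in `H1 × H1` with a quadratic, hence locally Lipschitz,
right-hand side: `H1` is an algebra and the Hilbert transform is bounded on it. Uniqueness is then
the usual ODE uniqueness, and a global solution follows from an a priori bound
(`exists_solution_Ici_of_apriori`).

The bound comes from `apriori_estimate`. At each fixed `x` the first equation is linear in `u`, so
`u` stays supported in the initial interval, and `u` is controlled by `u_x` through Poincaré-type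
inequalities with powers of `δ`. Put `D = ‖u_x‖²` and `y(t) = ∫₀ᵗ D`. Then `D' = 4 ∫ v u_x² + 4 ∫ u
u_x v_x ≤ 4 D (sup v + √δ ‖v_x‖)`, the supremum being taken over the interval. Integrating the
second equation gives `v ≤ -3 + 4δy` there and `‖v_x‖ ≤ ‖v_{0x}‖ + 2√δ y`, so that `D' ≤ 4 D (-3 +
√δ ‖v_{0x}‖ + 6δy)`. While `6δy ≤ 3/4`, the bracket is at most `-2`; then `D + 8y ≤ D(0)`, and the
smallness hypothesis improves this to `6δy ≤ 9/16`. The bootstrap closes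
(`decay_of_memory_inequality`), `‖u_x‖` decays like `e^{-4t}`, and `v` stays bounded.

The Hilbert transform is built without Fourier analysis. The autocorrelation of the conjugate
Poisson kernel at height `η` is the Poisson kernel at height `2η`, which has mass one, so
convolution with the conjugate kernel is an `L²` contraction (`eLpNorm_conjConv_le`). A weak limit
as `η → 0` along an ultrafilter is again a contraction, commutes with the weak derivative, and on
`H1` equals the principal value by dominated convergence (`exists_hilbertL2`). -/

theorem L2.locallyIntegrable (f : L2) : LocallyIntegrable f volume :=
  (Lp.memLp f).locallyIntegrable (by norm_num)

theorem L2.intervalIntegrable (f : L2) (a b : ℝ) : IntervalIntegrable f volume a b :=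
  ((L2.locallyIntegrable f).integrableOn_isCompact isCompact_uIcc).intervalIntegrable

theorem L2.integrable_mul (f g : L2) : Integrable fun x => f x * g x :=
  (Lp.memLp f).integrable_mul (q := 2) (Lp.memLp g)

theorem L2.inner_eq (f g : L2) : inner ℝ f g = ∫ x, f x * g x := by
  rw [L2.inner_def]
  refine integral_congr_ae (Eventually.of_forall fun x => ?_)
  simp [mul_comm]

theorem L2.norm_sq_eq (f : L2) : ‖f‖ ^ 2 = ∫ x, f x ^ 2 := by
  rw [← real_inner_self_eq_norm_sq, L2.inner_eq]
  simp only [sq]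

theorem L2.integrable_sq (f : L2) : Integrable fun x => f x ^ 2 := by
  simpa only [sq] using L2.integrable_mul f f

theorem L2.norm_toLp_sq {f : ℝ → ℝ} (hf : MemLp f 2 volume) :
    ‖hf.toLp f‖ ^ 2 = ∫ x, f x ^ 2 := by
  rw [L2.norm_sq_eq]
  refine integral_congr_ae ?_
  filter_upwards [hf.coeFn_toLp] with x hx
  rw [hx]

theorem L2.abs_intervalIntegral_le (g : L2) {a b : ℝ} (hab : a ≤ b) :
    |∫ x in a..b, g x| ≤ √(b - a) * ‖g‖ := by
  have hm : MeasurableSet (Ioc a b) := measurableSet_Ioc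
  have hfin : volume (Ioc a b) ≠ ⊤ := measure_Ioc_lt_top.ne
  have h := L2.inner_indicatorConstLp_one (𝕜 := ℝ) hm hfin g
  rw [intervalIntegral.integral_of_le hab, ← h]
  refine (abs_real_inner_le_norm _ _).trans ?_
  rw [norm_indicatorConstLp (by norm_num) (by norm_num)]
  simp [Real.sqrt_eq_rpow, measureReal_def, hab]

/-! ### Functions with a locally integrable weak derivative -/

theorem absolutelyContinuousOnInterval_of_primitive {F g : ℝ → ℝ}
    (hg : LocallyIntegrable g volume) (hF : ∀ a b, F b - F a = ∫ x in a..b, g x) (a b : ℝ) :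
    AbsolutelyContinuousOnInterval F a b := by
  have hi : IntervalIntegrable g volume a b :=
    (hg.integrableOn_isCompact isCompact_uIcc).intervalIntegrable
  have h1 := hi.absolutelyContinuousOnInterval_intervalIntegral (c := a) left_mem_uIcc
  have h2 : AbsolutelyContinuousOnInterval (fun _ : ℝ => F a) a b :=
    (contDiff_const.contDiffOn).absolutelyContinuousOnInterval
  have e : F = (fun _ => F a) + fun x => ∫ t in a..x, g t := by
    funext x
    simp [← hF a x]
  rw [e]
  exact h2.add h1

theorem ae_hasDerivAt_of_primitive {F g : ℝ → ℝ}
    (hg : LocallyIntegrable g volume) (hF : ∀ a b, F b - F a = ∫ x in a..b, g x) :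
    ∀ᵐ x, HasDerivAt F (g x) x := by
  filter_upwards [_root_.LocallyIntegrable.ae_hasDerivAt_integral hg] with x hx
  have e : F = fun x => F 0 + ∫ t in (0 : ℝ)..x, g t := by
    funext y
    simp [← hF 0 y]
  rw [e]
  exact (hx 0).const_add (F 0)

theorem continuous_of_primitive {F g : ℝ → ℝ}
    (hg : LocallyIntegrable g volume) (hF : ∀ a b, F b - F a = ∫ x in a..b, g x) :
    Continuous F := by
  have h : F = fun x => F 0 + ∫ t in (0 : ℝ)..x, g t := by
    funext y
    simp [← hF 0 y]
  rw [h]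
  exact continuous_const.add (intervalIntegral.continuous_primitive
    (fun a b => (hg.integrableOn_isCompact isCompact_uIcc).intervalIntegrable) 0)

theorem exists_tsupport_subset_Ioo {φ : ℝ → ℝ} (hs : HasCompactSupport φ) :
    ∃ R > 0, tsupport φ ⊆ Ioo (-R) R := by
  obtain ⟨R, hR, h⟩ := hs.isCompact.isBounded.subset_ball_lt 0 0
  refine ⟨R, hR, ?_⟩
  simpa [Real.ball_eq_Ioo] using h

theorem integral_eq_intervalIntegral_of_tsupport {φ h : ℝ → ℝ} {R : ℝ}
    (hR : tsupport φ ⊆ Ioo (-R) R) (hh : ∀ x, x ∉ tsupport φ → h x = 0) :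
    ∫ x, h x = ∫ x in (-R)..R, h x := by
  refine (intervalIntegral.integral_eq_integral_of_support_subset fun x hx => ?_).symm
  have : x ∈ tsupport φ := by
    by_contra hc
    exact hx (hh x hc)
  exact Ioo_subset_Ioc_self (hR this)

theorem isWeakDeriv_of_primitive {F g : ℝ → ℝ}
    (hg : LocallyIntegrable g volume) (hF : ∀ a b, F b - F a = ∫ x in a..b, g x) :
    IsWeakDeriv F g := by
  intro φ hφ hs
  obtain ⟨R, hR0, hR⟩ := exists_tsupport_subset_Ioo hs
  have hz : ∀ x, x ∉ tsupport φ → φ x = 0 := fun x hx => image_eq_zero_of_notMem_tsupport hx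
  have hdz : ∀ x, x ∉ tsupport φ → deriv φ x = 0 := fun x hx =>
    Function.notMem_support.1 fun hc => hx (support_deriv_subset hc)
  have hφ1 : ContDiff ℝ 1 φ := hφ.of_le (by simp)
  rw [integral_eq_intervalIntegral_of_tsupport hR (fun x hx => by simp [hdz x hx]),
    integral_eq_intervalIntegral_of_tsupport hR (h := fun x => g x * φ x)
      (fun x hx => by simp [hz x hx]),
    (absolutelyContinuousOnInterval_of_primitive hg hF _ _).integral_mul_deriv_eq_deriv_mul
      hφ1.contDiffOn.absolutelyContinuousOnInterval,
    hz R (fun h => lt_irrefl _ (hR h).2), hz (-R) (fun h => lt_irrefl _ (hR h).1)]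
  have : ∫ x in (-R)..R, deriv F x * φ x = ∫ x in (-R)..R, g x * φ x := by
    refine intervalIntegral.integral_congr_ae ?_
    filter_upwards [ae_hasDerivAt_of_primitive hg hF] with x hx _
    rw [hx.deriv]
  rw [this]
  ring

theorem IsWeakDeriv.congr_ae {f f' g g' : ℝ → ℝ} (h : IsWeakDeriv f g) (hf : f =ᵐ[volume] f')
    (hg : g =ᵐ[volume] g') : IsWeakDeriv f' g' := by
  intro φ hφ hs
  have h1 : ∫ x, f' x * deriv φ x = ∫ x, f x * deriv φ x :=
    integral_congr_ae (by filter_upwards [hf] with x hx; rw [hx])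
  have h2 : ∫ x, g' x * φ x = ∫ x, g x * φ x :=
    integral_congr_ae (by filter_upwards [hg] with x hx; rw [hx])
  rw [h1, h2, h φ hφ hs]

/-- The primitive starting at `-R` vanishes to the left of the support, and to the right it equals
the total integral, which is zero. -/
theorem exists_testFunction_deriv_eq {ψ : ℝ → ℝ} (hψ : ContDiff ℝ ∞ ψ) (hs : HasCompactSupport ψ)
    (h0 : ∫ x, ψ x = 0) : ∃ φ : ℝ → ℝ, ContDiff ℝ ∞ φ ∧ HasCompactSupport φ ∧ deriv φ = ψ := by
  obtain ⟨R, hR0, hR⟩ := exists_tsupport_subset_Ioo hs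
  have hz : ∀ x, x ∉ tsupport ψ → ψ x = 0 := fun x hx => image_eq_zero_of_notMem_tsupport hx
  have hd : ∀ x, HasDerivAt (fun x => ∫ t in (-R)..x, ψ t) (ψ x) x := fun x =>
    intervalIntegral.integral_hasDerivAt_right (hψ.continuous.intervalIntegrable _ _)
      (hψ.continuous.stronglyMeasurableAtFilter _ _) hψ.continuous.continuousAt
  have hd' : deriv (fun x => ∫ t in (-R)..x, ψ t) = ψ := funext fun x => (hd x).deriv
  refine ⟨fun x => ∫ t in (-R)..x, ψ t, ?_, ?_, hd'⟩
  · rw [contDiff_infty_iff_deriv, hd']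
    exact ⟨fun x => (hd x).differentiableAt, hψ⟩
  · refine HasCompactSupport.intro (isCompact_Icc (a := -R) (b := R)) fun x hx => ?_
    have hout : ∀ a b : ℝ, (∀ t ∈ uIcc a b, t ∉ Ioo (-R) R) → ∫ t in a..b, ψ t = 0 := by
      intro a b hab
      rw [intervalIntegral.integral_congr (g := fun _ => (0 : ℝ))
        (fun t ht => hz t fun hc => hab t ht (hR hc))]
      simp
    rcases lt_or_ge x (-R) with h | h
    · refine hout _ _ fun t ht => ?_
      rw [uIcc_of_ge h.le] at ht
      exact fun hc => absurd hc.1 (not_lt.2 ht.2)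
    · have h' : R < x := by
        by_contra hc
        exact hx ⟨h, not_lt.1 hc⟩
      rw [← intervalIntegral.integral_add_adjacent_intervals (b := R)
        (hψ.continuous.intervalIntegrable _ _) (hψ.continuous.intervalIntegrable _ _),
        ← integral_eq_intervalIntegral_of_tsupport hR hz, h0, hout R x, add_zero]
      intro t ht
      rw [uIcc_of_le h'.le] at ht
      exact fun hc => absurd hc.2 (not_lt.2 ht.1)

theorem integrable_mul_testFunction {h : ℝ → ℝ} (hh : LocallyIntegrable h volume)
    {φ : ℝ → ℝ} (hφ : Continuous φ) (hs : HasCompactSupport φ) :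
    Integrable fun x => h x * φ x := by
  simpa only [smul_eq_mul, mul_comm] using
    hh.integrable_smul_left_of_hasCompactSupport hφ hs

/-- The lemma of du Bois-Reymond. -/
theorem ae_eq_const_of_integral_mul_deriv_eq_zero {h : ℝ → ℝ} (hh : LocallyIntegrable h volume)
    (h0 : ∀ φ : ℝ → ℝ, ContDiff ℝ ∞ φ → HasCompactSupport φ → ∫ x, h x * deriv φ x = 0) :
    ∃ c : ℝ, ∀ᵐ x, h x = c := by
  let B : ContDiffBump (0 : ℝ) := default
  set ρ : ℝ → ℝ := B.normed volume with hρ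
  have hρ1 : ∫ x, ρ x = 1 := B.integral_normed
  have hρs : HasCompactSupport ρ := B.hasCompactSupport_normed
  have hρc : ContDiff ℝ ∞ ρ := B.contDiff_normed
  -- For any test function `ψ`, the function `ψ - (∫ ψ) ρ` has mean zero, hence is the derivative of
  -- a test function. Testing `h` against it gives `∫ h ψ = (∫ h ρ) ∫ ψ`, which identifies the
  -- constant.
  refine ⟨∫ x, h x * ρ x, ?_⟩
  refine ae_eq_of_integral_contDiff_smul_eq hh (locallyIntegrable_const _) fun ψ hψ hs => ?_
  have hψi : Integrable ψ := hψ.continuous.integrable_of_hasCompactSupport hs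
  have hρi : Integrable ρ := hρc.continuous.integrable_of_hasCompactSupport hρs
  have hzs : HasCompactSupport fun x => ψ x - (∫ y, ψ y) * ρ x := by
    have := hs.add (hρs.mul_left (f := fun _ => -(∫ y, ψ y)))
    have e : (fun x => ψ x - (∫ y, ψ y) * ρ x) = ψ + (fun _ => -∫ y, ψ y) * ρ := by
      funext x
      simp [sub_eq_add_neg]
    rw [e]
    exact this
  have hzc : ContDiff ℝ ∞ fun x => ψ x - (∫ y, ψ y) * ρ x := hψ.sub (contDiff_const.mul hρc)
  obtain ⟨φ, hφ, hφs, hd⟩ := exists_testFunction_deriv_eq hzc hzs (by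
    rw [integral_sub hψi (hρi.const_mul _), integral_const_mul, hρ1]
    ring)
  have key := h0 φ hφ hφs
  rw [hd] at key
  have e : ∀ x, h x * (ψ x - (∫ y, ψ y) * ρ x) = h x * ψ x - (∫ y, ψ y) * (h x * ρ x) := by
    intro x; ring
  simp only [e] at key
  rw [integral_sub (integrable_mul_testFunction hh hψ.continuous hs)
    ((integrable_mul_testFunction hh hρc.continuous hρs).const_mul _), integral_const_mul] at key
  simp only [smul_eq_mul, integral_mul_const]
  simp only [mul_comm (ψ _)]
  linarith

/-! ### The Hilbert space `H¹` -/

/-- The element of `H¹` with given underlying function and weak derivative. -/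
def H1.mk (f g : L2) (h : IsWeakDeriv f g) : H1 := ⟨WithLp.toLp 2 (f, g), h⟩

theorem H1.isWeakDeriv (f : H1) : IsWeakDeriv f.fn f.dx := f.2

/-- The underlying function, as a continuous linear map. -/
noncomputable def H1.fnL : H1 →L[ℝ] L2 := (WithLp.fstL 2 ℝ L2 L2).comp H1Submodule.subtypeL

/-- The weak derivative, as a continuous linear map. -/
noncomputable def H1.dxL : H1 →L[ℝ] L2 := (WithLp.sndL 2 ℝ L2 L2).comp H1Submodule.subtypeL

@[simp] theorem H1.fnL_apply (f : H1) : H1.fnL f = f.fn := rfl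

@[simp] theorem H1.dxL_apply (f : H1) : H1.dxL f = f.dx := rfl

theorem H1.norm_sq_eq (f : H1) : ‖f‖ ^ 2 = ‖f.fn‖ ^ 2 + ‖f.dx‖ ^ 2 :=
  WithLp.prod_norm_sq_eq_of_L2 (f : WithLp 2 (L2 × L2))

theorem H1.norm_fn_le (f : H1) : ‖f.fn‖ ≤ ‖f‖ := by
  refine le_of_sq_le_sq ?_ (norm_nonneg _)
  nlinarith [H1.norm_sq_eq f, sq_nonneg ‖f.dx‖]

theorem H1.norm_dx_le (f : H1) : ‖f.dx‖ ≤ ‖f‖ := by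
  refine le_of_sq_le_sq ?_ (norm_nonneg _)
  nlinarith [H1.norm_sq_eq f, sq_nonneg ‖f.fn‖]

theorem H1.norm_le (f : H1) : ‖f‖ ≤ ‖f.fn‖ + ‖f.dx‖ := by
  refine le_of_sq_le_sq ?_ (by positivity)
  nlinarith [H1.norm_sq_eq f, mul_nonneg (norm_nonneg f.fn) (norm_nonneg f.dx)]

/-- This yields completeness of `H1`, needed to solve the ODE. Each test function imposes an
equality between two `L²`-continuous functionals, because its pairings are inner products. -/
theorem isClosed_H1Submodule : IsClosed (H1Submodule : Set (WithLp 2 (L2 × L2))) := by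
  have e : (H1Submodule : Set (WithLp 2 (L2 × L2))) =
      ⋂ (φ : ℝ → ℝ) (_ : ContDiff ℝ ∞ φ) (_ : HasCompactSupport φ),
        {p | ∫ x, p.fst x * deriv φ x = -∫ x, p.snd x * φ x} := by
    ext p
    simp only [mem_iInter]
    exact Iff.rfl
  rw [e]
  refine isClosed_iInter fun φ => isClosed_iInter fun hφ => isClosed_iInter fun hs => ?_
  have key : ∀ {ψ : ℝ → ℝ}, Continuous ψ → HasCompactSupport ψ →
      Continuous fun f : L2 => ∫ x, f x * ψ x := by
    intro ψ hc hψ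
    have hm : MemLp ψ 2 volume := hc.memLp_of_hasCompactSupport hψ
    have e : (fun f : L2 => ∫ x, f x * ψ x) = fun f => inner ℝ f (hm.toLp ψ) := by
      funext f
      rw [L2.inner_eq]
      refine integral_congr_ae ?_
      filter_upwards [hm.coeFn_toLp] with x hx
      rw [hx]
    rw [e]
    fun_prop
  exact isClosed_eq
    ((key (hφ.continuous_deriv (by simp)) hs.deriv).comp (WithLp.continuous_fst 2 L2 L2))
    ((key hφ.continuous hs).comp (WithLp.continuous_snd 2 L2 L2)).neg

instance : CompleteSpace H1 := isClosed_H1Submodule.completeSpace_coe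

/-- The difference between `f` and a primitive of `f_x` has zero weak derivative, so du Bois-Reymond
applies. -/
theorem H1.exists_primitive (f : H1) :
    ∃ c : ℝ, ∀ᵐ x, f.fn x = c + ∫ t in (0 : ℝ)..x, f.dx t := by
  have hP : ∀ a b, (∫ t in (0 : ℝ)..b, f.dx t) - (∫ t in (0 : ℝ)..a, f.dx t) =
      ∫ t in a..b, f.dx t := fun a b =>
    intervalIntegral.integral_interval_sub_left (L2.intervalIntegrable _ _ _)
      (L2.intervalIntegrable _ _ _)
  have hl := L2.locallyIntegrable f.dx
  have hc := continuous_of_primitive hl hP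
  have hw := isWeakDeriv_of_primitive hl hP
  have hd : LocallyIntegrable (fun x => f.fn x - ∫ t in (0 : ℝ)..x, f.dx t) volume :=
    (L2.locallyIntegrable f.fn).sub hc.locallyIntegrable
  obtain ⟨c, h⟩ := ae_eq_const_of_integral_mul_deriv_eq_zero hd (by
    intro φ hφ hs
    have hdc : Continuous (deriv φ) := hφ.continuous_deriv (by simp)
    simp only [sub_mul]
    rw [integral_sub (integrable_mul_testFunction (L2.locallyIntegrable f.fn) hdc hs.deriv)
      (integrable_mul_testFunction hc.locallyIntegrable hdc hs.deriv), hw φ hφ hs,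
      f.isWeakDeriv φ hφ hs, sub_self])
  refine ⟨c, ?_⟩
  filter_upwards [h] with x hx
  linarith

/-- The continuous representative of an element of `H¹`. -/
noncomputable def H1.rep (f : H1) : ℝ → ℝ :=
  fun x => f.exists_primitive.choose + ∫ t in (0 : ℝ)..x, f.dx t

theorem H1.fn_ae_eq (f : H1) : f.fn =ᵐ[volume] f.rep := f.exists_primitive.choose_spec

theorem H1.rep_sub (f : H1) (a b : ℝ) : f.rep b - f.rep a = ∫ t in a..b, f.dx t := by
  simp only [H1.rep, add_sub_add_left_eq_sub]
  exact intervalIntegral.integral_interval_sub_left (L2.intervalIntegrable _ _ _)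
      (L2.intervalIntegrable _ _ _)

theorem H1.continuous_rep (f : H1) : Continuous f.rep :=
  continuous_of_primitive (L2.locallyIntegrable f.dx) f.rep_sub

theorem H1.rep_eq_of_ae {f : H1} {F : ℝ → ℝ} (hF : Continuous F) (h : f.fn =ᵐ[volume] F) :
    f.rep = F :=
  (f.continuous_rep.ae_eq_iff_eq volume hF).1 (f.fn_ae_eq.symm.trans h)

theorem H1.ext_rep {f g : H1} (h : f.rep = g.rep) : f = g := by
  have hfn : f.fn = g.fn := Lp.ext (f.fn_ae_eq.trans ((EventuallyEq.of_eq h).trans g.fn_ae_eq.symm))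
  have hdx : f.dx = g.dx := by
    refine Lp.ext ?_
    have h1 := ae_hasDerivAt_of_primitive (L2.locallyIntegrable f.dx) f.rep_sub
    have h2 := ae_hasDerivAt_of_primitive (L2.locallyIntegrable g.dx) g.rep_sub
    filter_upwards [h1, h2] with x hx hx'
    rw [← h] at hx'
    exact hx.unique hx'
  exact Subtype.ext (WithLp.ofLp_injective 2 (Prod.ext hfn hdx))

theorem H1.ext_fn {f g : H1} (h : f.fn =ᵐ[volume] g.fn) : f = g :=
  H1.ext_rep (H1.rep_eq_of_ae g.continuous_rep (h.trans g.fn_ae_eq))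

theorem H1.rep_add (f g : H1) : (f + g).rep = f.rep + g.rep := by
  refine H1.rep_eq_of_ae (f.continuous_rep.add g.continuous_rep) ?_
  exact (Lp.coeFn_add f.fn g.fn).trans (f.fn_ae_eq.add g.fn_ae_eq)

theorem H1.rep_smul (c : ℝ) (f : H1) : (c • f).rep = c • f.rep := by
  refine H1.rep_eq_of_ae (f.continuous_rep.const_smul c) ?_
  exact (Lp.coeFn_smul c f.fn).trans (f.fn_ae_eq.const_smul c)

theorem H1.abs_rep_sub_le (f : H1) {a b : ℝ} (hab : a ≤ b) :
    |f.rep b - f.rep a| ≤ √(b - a) * ‖f.dx‖ := by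
  rw [H1.rep_sub]
  exact L2.abs_intervalIntegral_le _ hab

theorem H1.memLp_rep (f : H1) : MemLp f.rep 2 volume := (memLp_congr_ae f.fn_ae_eq).1 (Lp.memLp _)

theorem H1.norm_fn_sq (f : H1) : ‖f.fn‖ ^ 2 = ∫ x, f.rep x ^ 2 := by
  rw [L2.norm_sq_eq]
  refine integral_congr_ae ?_
  filter_upwards [f.fn_ae_eq] with x hx
  rw [hx]

/-- If `|f(x)|` exceeds `√l ‖f_x‖` by `m > 0`, then `|f| ≥ m` on `[x, x + l]`, so `‖f‖² ≥ l m²`. The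
length `l` is left free: `l = 1` gives the Sobolev embedding, and `l = δ` gives the correct scaling
for `H(u²)`, which has no compact support. -/
theorem H1.sqrt_mul_abs_rep_le (f : H1) {l : ℝ} (hl : 0 < l) (x : ℝ) :
    √l * |f.rep x| ≤ ‖f.fn‖ + l * ‖f.dx‖ := by
  have hs : 0 < √l := Real.sqrt_pos.2 hl
  have hsq : √l * √l = l := Real.mul_self_sqrt hl.le
  set m := |f.rep x| - √l * ‖f.dx‖ with hm
  suffices h : √l * m ≤ ‖f.fn‖ by
    have : √l * |f.rep x| = √l * m + l * ‖f.dx‖ := by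
      rw [hm, mul_sub, ← mul_assoc, hsq]; ring
    linarith
  rcases le_or_gt m 0 with h0 | h0
  · exact (mul_nonpos_of_nonneg_of_nonpos hs.le h0).trans (norm_nonneg _)
  · refine le_of_sq_le_sq ?_ (norm_nonneg _)
    rw [H1.norm_fn_sq, mul_pow, Real.sq_sqrt hl.le]
    have hi : Integrable fun x => f.rep x ^ 2 := f.memLp_rep.integrable_sq
    calc l * m ^ 2 = ∫ _ in Icc x (x + l), m ^ 2 := by
          simp [measureReal_def, hl.le]
      _ ≤ ∫ y in Icc x (x + l), f.rep y ^ 2 := by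
          refine setIntegral_mono_on (by simp) hi.integrableOn measurableSet_Icc fun y hy => ?_
          have h1 := f.abs_rep_sub_le hy.1
          have h2 : √(y - x) ≤ √l := Real.sqrt_le_sqrt (by linarith [hy.2])
          have h3 := mul_le_mul_of_nonneg_right h2 (norm_nonneg f.dx)
          have h4 : |f.rep x| - |f.rep y| ≤ |f.rep y - f.rep x| := by
            rw [abs_sub_comm]; exact abs_sub_abs_le_abs_sub _ _
          rw [← sq_abs (f.rep y)]
          exact pow_le_pow_left₀ h0.le (by linarith) 2
      _ ≤ ∫ y, f.rep y ^ 2 :=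
          setIntegral_le_integral hi (Eventually.of_forall fun y => sq_nonneg _)

theorem H1.abs_rep_le (f : H1) (x : ℝ) : |f.rep x| ≤ ‖f.fn‖ + ‖f.dx‖ := by
  simpa using f.sqrt_mul_abs_rep_le one_pos x

theorem H1.abs_rep_le_norm (f : H1) (x : ℝ) : |f.rep x| ≤ 2 * ‖f‖ := by
  linarith [f.abs_rep_le x, f.norm_fn_le, f.norm_dx_le]

/-- Evaluation of the continuous representative at a point. -/
noncomputable def H1.evalL (x : ℝ) : H1 →L[ℝ] ℝ :=
  LinearMap.mkContinuous
    { toFun := fun f => f.rep x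
      map_add' := fun f g => by rw [H1.rep_add, Pi.add_apply]
      map_smul' := fun c f => by rw [H1.rep_smul, Pi.smul_apply, RingHom.id_apply] }
    2 fun f => f.abs_rep_le_norm x

@[simp] theorem H1.evalL_apply (x : ℝ) (f : H1) : H1.evalL x f = f.rep x := rfl

/-! ### `H¹` is an algebra -/

theorem memLp_bdd_mul {f g : ℝ → ℝ} (hf : Continuous f) {C : ℝ} (hC : ∀ x, |f x| ≤ C)
    (hg : MemLp g 2 volume) : MemLp (fun x => f x * g x) 2 volume := by
  refine hg.of_le_mul (c := C) (hf.aestronglyMeasurable.mul hg.1) ?_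
  refine Eventually.of_forall fun x => ?_
  rw [norm_mul]
  exact mul_le_mul_of_nonneg_right (hC x) (norm_nonneg _)

theorem norm_toLp_le_of_abs_le {f : ℝ → ℝ} (hf : MemLp f 2 volume) (g : L2) {C : ℝ}
    (h : ∀ᵐ x, |f x| ≤ C * |g x|) : ‖hf.toLp f‖ ≤ C * ‖g‖ := by
  refine Lp.norm_le_mul_norm_of_ae_le_mul ?_
  filter_upwards [h, hf.coeFn_toLp] with x hx hx'
  rwa [hx', Real.norm_eq_abs, Real.norm_eq_abs]

/-- The product of a bounded continuous function (an element of `H¹`) and an `L²` function. -/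
noncomputable def H1.mulL2 (f : H1) (g : L2) : L2 :=
  (memLp_bdd_mul f.continuous_rep f.abs_rep_le_norm (Lp.memLp g)).toLp _

theorem H1.coeFn_mulL2 (f : H1) (g : L2) :
    f.mulL2 g =ᵐ[volume] fun x => f.rep x * g x := MemLp.coeFn_toLp _

theorem H1.norm_mulL2_le (f : H1) (g : L2) {C : ℝ} (hC : ∀ x, |f.rep x| ≤ C) :
    ‖f.mulL2 g‖ ≤ C * ‖g‖ :=
  norm_toLp_le_of_abs_le _ g (Eventually.of_forall fun x => by
    rw [abs_mul]
    exact mul_le_mul_of_nonneg_right (hC x) (abs_nonneg _))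

theorem H1.rep_mul_sub (f g : H1) (a b : ℝ) :
    f.rep b * g.rep b - f.rep a * g.rep a =
      ∫ x in a..b, f.dx x * g.rep x + f.rep x * g.dx x := by
  have hf := absolutelyContinuousOnInterval_of_primitive (L2.locallyIntegrable f.dx) f.rep_sub a b
  have hg := absolutelyContinuousOnInterval_of_primitive (L2.locallyIntegrable g.dx) g.rep_sub a b
  rw [← hf.integral_deriv_mul_eq_sub hg]
  refine intervalIntegral.integral_congr_ae ?_
  filter_upwards [ae_hasDerivAt_of_primitive (L2.locallyIntegrable f.dx) f.rep_sub,
    ae_hasDerivAt_of_primitive (L2.locallyIntegrable g.dx) g.rep_sub] with x h1 h2 _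
  rw [h1.deriv, h2.deriv]

theorem H1.isWeakDeriv_mul (f g : H1) :
    IsWeakDeriv (f.mulL2 g.fn) (g.mulL2 f.dx + f.mulL2 g.dx : L2) := by
  have hae : (g.mulL2 f.dx + f.mulL2 g.dx : L2) =ᵐ[volume]
      fun x => f.dx x * g.rep x + f.rep x * g.dx x := by
    filter_upwards [Lp.coeFn_add (g.mulL2 f.dx) (f.mulL2 g.dx), g.coeFn_mulL2 f.dx,
      f.coeFn_mulL2 g.dx] with x h h1 h2
    rw [h, Pi.add_apply, h1, h2, mul_comm (g.rep x)]
  refine (isWeakDeriv_of_primitive (F := fun x => f.rep x * g.rep x)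
    (L2.locallyIntegrable (g.mulL2 f.dx + f.mulL2 g.dx)) ?_).congr_ae ?_ (EventuallyEq.refl _ _)
  · intro a b
    rw [f.rep_mul_sub g]
    refine intervalIntegral.integral_congr_ae ?_
    filter_upwards [hae] with x hx _
    rw [hx]
  · filter_upwards [f.coeFn_mulL2 g.fn, g.fn_ae_eq] with x h1 h2
    rw [h1, h2]

/-- The product of two elements of `H¹`. -/
noncomputable def H1.mul (f g : H1) : H1 := H1.mk _ _ (f.isWeakDeriv_mul g)

theorem H1.fn_mul (f g : H1) : (f.mul g).fn = f.mulL2 g.fn := rfl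

theorem H1.dx_mul (f g : H1) : (f.mul g).dx = g.mulL2 f.dx + f.mulL2 g.dx := rfl

theorem H1.rep_mul (f g : H1) : (f.mul g).rep = fun x => f.rep x * g.rep x := by
  refine H1.rep_eq_of_ae (f.continuous_rep.mul g.continuous_rep) ?_
  filter_upwards [f.coeFn_mulL2 g.fn, g.fn_ae_eq] with x h1 h2
  rw [H1.fn_mul, h1, h2]

theorem H1.norm_mul_le (f g : H1) : ‖f.mul g‖ ≤ 6 * ‖f‖ * ‖g‖ := by
  have h1 := f.norm_mulL2_le g.fn f.abs_rep_le_norm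
  have h2 := f.norm_mulL2_le g.dx f.abs_rep_le_norm
  have h3 := g.norm_mulL2_le f.dx g.abs_rep_le_norm
  have h4 := (f.mul g).norm_le
  rw [H1.fn_mul, H1.dx_mul] at h4
  have h5 := norm_add_le (g.mulL2 f.dx) (f.mulL2 g.dx)
  have h6 := mul_le_mul_of_nonneg_left g.norm_fn_le (norm_nonneg f)
  have h7 := mul_le_mul_of_nonneg_left g.norm_dx_le (norm_nonneg f)
  have h8 := mul_le_mul_of_nonneg_left f.norm_dx_le (norm_nonneg g)
  nlinarith

/-- Multiplication on `H¹`, as a continuous bilinear map. -/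
noncomputable def H1.mulL : H1 →L[ℝ] H1 →L[ℝ] H1 :=
  LinearMap.mkContinuous₂
    (LinearMap.mk₂ ℝ H1.mul
      (fun f g h => H1.ext_rep (by
        rw [H1.rep_mul, H1.rep_add, H1.rep_add, H1.rep_mul, H1.rep_mul]
        funext x; simp only [Pi.add_apply]; ring))
      (fun c f g => H1.ext_rep (by
        rw [H1.rep_mul, H1.rep_smul, H1.rep_smul, H1.rep_mul]
        funext x; simp only [Pi.smul_apply, smul_eq_mul]; ring))
      (fun f g h => H1.ext_rep (by
        rw [H1.rep_mul, H1.rep_add, H1.rep_add, H1.rep_mul, H1.rep_mul]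
        funext x; simp only [Pi.add_apply]; ring))
      (fun c f g => H1.ext_rep (by
        rw [H1.rep_mul, H1.rep_smul, H1.rep_smul, H1.rep_mul]
        funext x; simp only [Pi.smul_apply, smul_eq_mul]; ring)))
    6 H1.norm_mul_le

@[simp] theorem H1.mulL_apply (f g : H1) : H1.mulL f g = f.mul g := rfl

/-! ### The conjugate Poisson kernel -/

/-- The conjugate Poisson kernel of the upper half plane. -/
noncomputable def conjKernel (η s : ℝ) : ℝ := Real.pi⁻¹ * (s / (s ^ 2 + η ^ 2))

/-- The Poisson kernel of the upper half plane. -/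
noncomputable def poissonKer (η s : ℝ) : ℝ := Real.pi⁻¹ * (η / (s ^ 2 + η ^ 2))

theorem continuous_conjKernel {η : ℝ} (hη : 0 < η) : Continuous (conjKernel η) := by
  unfold conjKernel
  exact continuous_const.mul (continuous_id.div (by fun_prop) fun s => by positivity)

theorem continuous_poissonKer {η : ℝ} (hη : 0 < η) : Continuous (poissonKer η) := by
  unfold poissonKer
  exact continuous_const.mul (continuous_const.div (by fun_prop) fun s => by positivity)

theorem poissonKer_eq {η : ℝ} (hη : 0 < η) (s : ℝ) :
    poissonKer η s = (Real.pi⁻¹ * η⁻¹) * (1 + (s / η) ^ 2)⁻¹ := by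
  unfold poissonKer
  field_simp
  ring

theorem integrable_poissonKer {η : ℝ} (hη : 0 < η) : Integrable (poissonKer η) := by
  simp only [funext (poissonKer_eq hη)]
  exact (integrable_inv_one_add_sq.comp_div hη.ne').const_mul _

theorem integral_poissonKer {η : ℝ} (hη : 0 < η) : ∫ s, poissonKer η s = 1 := by
  simp only [poissonKer_eq hη]
  rw [integral_const_mul, Measure.integral_comp_div (fun s : ℝ => (1 + s ^ 2)⁻¹) η,
    integral_univ_inv_one_add_sq, abs_of_pos hη, smul_eq_mul]
  field_simp

theorem poissonKer_nonneg {η : ℝ} (hη : 0 < η) (s : ℝ) : 0 ≤ poissonKer η s := by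
  unfold poissonKer
  positivity

/-- The conjugate kernel decays only like `1/s` and is not integrable; this comparison puts it in
`L²`. -/
theorem conjKernel_sq_le {η : ℝ} (hη : 0 < η) (s : ℝ) :
    conjKernel η s ^ 2 ≤ (Real.pi⁻¹ * η⁻¹) * poissonKer η s := by
  have h : 0 < s ^ 2 + η ^ 2 := by positivity
  have e1 : conjKernel η s ^ 2 = Real.pi⁻¹ ^ 2 * (s ^ 2 / (s ^ 2 + η ^ 2) ^ 2) := by
    unfold conjKernel
    rw [mul_pow, div_pow]
  have e2 : (Real.pi⁻¹ * η⁻¹) * poissonKer η s =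
      Real.pi⁻¹ ^ 2 * ((s ^ 2 + η ^ 2) / (s ^ 2 + η ^ 2) ^ 2) := by
    unfold poissonKer
    field_simp
  rw [e1, e2]
  gcongr
  nlinarith [sq_nonneg η]

theorem memLp_conjKernel {η : ℝ} (hη : 0 < η) : MemLp (conjKernel η) 2 volume := by
  rw [memLp_two_iff_integrable_sq (continuous_conjKernel hη).aestronglyMeasurable]
  refine ((integrable_poissonKer hη).const_mul (Real.pi⁻¹ * η⁻¹)).mono'
    ((continuous_conjKernel hη).pow 2).aestronglyMeasurable (Eventually.of_forall fun s => ?_)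
  rw [Real.norm_of_nonneg (sq_nonneg _)]
  exact conjKernel_sq_le hη s

/-- Makes the logarithmic term of the antiderivative in `integral_conjKernel_mul_shift` vanish at
both ends. -/
theorem tendsto_quadratic_ratio (η d : ℝ) {l : Filter ℝ} (hl : Tendsto (fun x : ℝ => |x|) l atTop) :
    Tendsto (fun x : ℝ => ((x + d) ^ 2 + η ^ 2) / (x ^ 2 + η ^ 2)) l (𝓝 1) := by
  have hinv : Tendsto (fun x : ℝ => x⁻¹) l (𝓝 0) := by
    rw [tendsto_zero_iff_abs_tendsto_zero]
    simpa [Function.comp_def, abs_inv] using tendsto_inv_atTop_zero.comp hl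
  have h : Tendsto (fun x : ℝ => ((1 + d * x⁻¹) ^ 2 + η ^ 2 * x⁻¹ ^ 2) / (1 + η ^ 2 * x⁻¹ ^ 2)) l
      (𝓝 (((1 + d * 0) ^ 2 + η ^ 2 * 0 ^ 2) / (1 + η ^ 2 * 0 ^ 2))) := by
    refine Tendsto.div ?_ ?_ (by norm_num)
    · exact ((tendsto_const_nhds.add (hinv.const_mul d)).pow 2).add ((hinv.pow 2).const_mul _)
    · exact tendsto_const_nhds.add ((hinv.pow 2).const_mul _)
  simp only [mul_zero, add_zero, one_pow, ne_eq, OfNat.ofNat_ne_zero, not_false_eq_true, zero_pow,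
    div_one] at h
  refine h.congr' ?_
  filter_upwards [hl.eventually_gt_atTop 0] with x hx
  have hx0 : x ≠ 0 := abs_pos.1 hx
  field_simp

/-- With `A` and `B` as below, the partial fractions are `(A x + B)/(x² + η²)` and `(-A (x + d) +
B)/((x + d)² + η²)`. The logarithms contribute nothing at infinity and the two arctangents
contribute `2π B / η`. The coefficient `A` is singular at `d = 0`; excluding that value is harmless
because the diagonal is a null set. -/
theorem integral_conjKernel_mul_shift {η d : ℝ} (hη : 0 < η) (hd : d ≠ 0) :
    ∫ x, conjKernel η x * conjKernel η (x + d) = poissonKer (2 * η) d := by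
  have hpi := Real.pi_pos
  set A : ℝ := (d ^ 2 + 2 * η ^ 2) / (d * (d ^ 2 + 4 * η ^ 2)) with hA
  set B : ℝ := η ^ 2 / (d ^ 2 + 4 * η ^ 2) with hB
  set G : ℝ → ℝ := fun x => Real.pi⁻¹ ^ 2 *
    (-(A / 2) * Real.log (((x + d) ^ 2 + η ^ 2) / (x ^ 2 + η ^ 2)) +
      B / η * (Real.arctan (x / η) + Real.arctan ((x + d) / η))) with hG
  have hderiv : ∀ x, HasDerivAt G (conjKernel η x * conjKernel η (x + d)) x := by
    intro x
    have ha : 0 < x ^ 2 + η ^ 2 := by positivity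
    have hb : 0 < (x + d) ^ 2 + η ^ 2 := by positivity
    have hc : 0 < d ^ 2 + 4 * η ^ 2 := by positivity
    have h1 : HasDerivAt (fun x : ℝ => (x + d) ^ 2 + η ^ 2) (2 * (x + d)) x := by
      simpa using (((hasDerivAt_id x).add_const d).pow 2).add_const (η ^ 2)
    have h2 : HasDerivAt (fun x : ℝ => x ^ 2 + η ^ 2) (2 * x) x := by
      simpa using ((hasDerivAt_id x).pow 2).add_const (η ^ 2)
    have h3 := (h1.div h2 ha.ne').log (div_pos hb ha).ne'
    have h4 := ((hasDerivAt_id x).div_const η).arctan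
    have h5 := (((hasDerivAt_id x).add_const d).div_const η).arctan
    have h6 := ((h3.const_mul (-(A / 2))).add ((h4.add h5).const_mul (B / η))).const_mul
      (Real.pi⁻¹ ^ 2)
    refine h6.congr_deriv ?_
    simp only [conjKernel, id, hA, hB, Pi.div_apply]
    have e1 : 1 + (x / η) ^ 2 = (x ^ 2 + η ^ 2) / η ^ 2 := by field_simp; ring
    have e2 : 1 + ((x + d) / η) ^ 2 = ((x + d) ^ 2 + η ^ 2) / η ^ 2 := by field_simp; ring
    rw [e1, e2]
    generalize hbe : (x + d) ^ 2 + η ^ 2 = b at *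
    generalize hae : x ^ 2 + η ^ 2 = a at *
    generalize hce : d ^ 2 + 4 * η ^ 2 = c at *
    field_simp
    subst hbe hae hce
    ring
  have hint : Integrable fun x => conjKernel η x * conjKernel η (x + d) :=
    (memLp_conjKernel hη).integrable_mul (q := 2)
      ((memLp_conjKernel hη).comp_measurePreserving (measurePreserving_add_right volume d))
  have hlog : ∀ {l : Filter ℝ}, Tendsto (fun x : ℝ => |x|) l atTop →
      Tendsto (fun x => -(A / 2) * Real.log (((x + d) ^ 2 + η ^ 2) / (x ^ 2 + η ^ 2))) l (𝓝 0) := by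
    intro l hl
    have := ((tendsto_quadratic_ratio η d hl).log one_ne_zero).const_mul (-(A / 2))
    simpa using this
  have htop : Tendsto G atTop (𝓝 (Real.pi⁻¹ ^ 2 * (0 + B / η * (Real.pi / 2 + Real.pi / 2)))) := by
    refine ((hlog tendsto_abs_atTop_atTop).add (Tendsto.const_mul _ (Tendsto.add ?_ ?_))).const_mul _
    · exact (Real.tendsto_arctan_atTop.mono_right nhdsWithin_le_nhds).comp
        (tendsto_id.atTop_div_const hη)
    · exact (Real.tendsto_arctan_atTop.mono_right nhdsWithin_le_nhds).comp
        ((tendsto_atTop_add_const_right _ d tendsto_id).atTop_div_const hη)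
  have hbot : Tendsto G atBot
      (𝓝 (Real.pi⁻¹ ^ 2 * (0 + B / η * (-(Real.pi / 2) + -(Real.pi / 2))))) := by
    refine ((hlog tendsto_abs_atBot_atTop).add (Tendsto.const_mul _ (Tendsto.add ?_ ?_))).const_mul _
    · exact (Real.tendsto_arctan_atBot.mono_right nhdsWithin_le_nhds).comp
        (tendsto_id.atBot_div_const hη)
    · exact (Real.tendsto_arctan_atBot.mono_right nhdsWithin_le_nhds).comp
        ((tendsto_atBot_add_const_right _ d tendsto_id).atBot_div_const hη)
  rw [integral_of_hasDerivAt_of_tendsto hderiv hint hbot htop, hB, poissonKer]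
  have hc : 0 < d ^ 2 + 4 * η ^ 2 := by positivity
  have hc' : d ^ 2 + (2 * η) ^ 2 = d ^ 2 + 4 * η ^ 2 := by ring
  rw [hc']
  field_simp
  ring

theorem integral_conjKernel_sub_mul {η : ℝ} (hη : 0 < η) {y z : ℝ} (h : y ≠ z) :
    ∫ x, conjKernel η (x - y) * conjKernel η (x - z) = poissonKer (2 * η) (y - z) := by
  rw [← integral_conjKernel_mul_shift hη (sub_ne_zero.2 h),
    ← integral_sub_right_eq_self (fun x => conjKernel η x * conjKernel η (x + (y - z))) y]
  refine integral_congr_ae (Eventually.of_forall fun x => ?_)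
  simp only [sub_add_sub_cancel]

/-! ### Convolution with the conjugate Poisson kernel -/

theorem abs_mul_le_half_sq (a b : ℝ) : |a * b| ≤ (a ^ 2 + b ^ 2) / 2 := by
  rw [abs_le]
  constructor <;> nlinarith [sq_nonneg (a - b), sq_nonneg (a + b)]

theorem MemLp.comp_sub_left_two {w : ℝ → ℝ} (hw : MemLp w 2 volume) (x : ℝ) :
    MemLp (fun s => w (x - s)) 2 volume :=
  hw.comp_measurePreserving (Measure.measurePreserving_sub_left volume x)

theorem MemLp.comp_sub_right_two {w : ℝ → ℝ} (hw : MemLp w 2 volume) (x : ℝ) :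
    MemLp (fun s => w (s - x)) 2 volume :=
  hw.comp_measurePreserving (measurePreserving_sub_right volume x)

theorem integrable_conjKernel_mul {η : ℝ} (hη : 0 < η) {w : ℝ → ℝ} (hw : MemLp w 2 volume)
    (x : ℝ) : Integrable fun s => conjKernel η s * w (x - s) :=
  (memLp_conjKernel hη).integrable_mul (q := 2) (MemLp.comp_sub_left_two hw x)

/-- The convolution of a function with the conjugate Poisson kernel. -/
noncomputable def conjConv (η : ℝ) (w : ℝ → ℝ) (x : ℝ) : ℝ := ∫ s, conjKernel η s * w (x - s)

theorem conjConv_eq (η : ℝ) (w : ℝ → ℝ) (x : ℝ) :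
    conjConv η w x = ∫ y, conjKernel η (x - y) * w y := by
  rw [← integral_sub_left_eq_self (fun y => conjKernel η (x - y) * w y) volume x]
  simp only [sub_sub_cancel]
  rfl

theorem integral_mul_shift_le {w : ℝ → ℝ} (h2 : MemLp w 2 volume) (r : ℝ) :
    ∫ y, |w y * w (y - r)| ≤ ∫ y, w y ^ 2 := by
  have hi := h2.integrable_sq
  have hi' := (MemLp.comp_sub_right_two h2 r).integrable_sq
  have e : ∫ y, w (y - r) ^ 2 = ∫ y, w y ^ 2 :=
    integral_sub_right_eq_self (fun y => w y ^ 2) r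
  calc ∫ y, |w y * w (y - r)| ≤ ∫ y, (w y ^ 2 + w (y - r) ^ 2) / 2 :=
        integral_mono ((h2.integrable_mul (q := 2) (MemLp.comp_sub_right_two h2 r)).abs)
          ((hi.add hi').div_const 2) fun y => abs_mul_le_half_sq _ _
    _ = ∫ y, w y ^ 2 := by
        rw [integral_div, integral_add hi hi', e]
        ring

/-- With `r = y - z` the double integral becomes an average, against the probability density
`poissonKer η`, of the correlations `∫ w(y) w(y - r) dy`, each at most `∫ w²`. -/
theorem integral_poissonKer_bilinear_le {η : ℝ} (hη : 0 < η) {w : ℝ → ℝ} (hm : Measurable w)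
    (h2 : MemLp w 2 volume) :
    ∫ y, ∫ z, w y * w z * poissonKer η (y - z) ≤ ∫ y, w y ^ 2 := by
  have hP := continuous_poissonKer hη
  have hint : Integrable (Function.uncurry fun y r => w y * w (y - r) * poissonKer η r)
      (volume.prod volume) := by
    have hms : AEStronglyMeasurable (Function.uncurry fun y r => w y * w (y - r) * poissonKer η r)
        (volume.prod volume) := by
      refine Measurable.aestronglyMeasurable ?_
      have := hP.measurable
      simp only [Function.uncurry_def]
      fun_prop
    rw [integrable_prod_iff' hms]
    refine ⟨Eventually.of_forall fun r => ?_, ?_⟩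
    · have h : Integrable fun y => w y * w (y - r) :=
        h2.integrable_mul (q := 2) (MemLp.comp_sub_right_two h2 r)
      exact h.mul_const (poissonKer η r)
    · refine ((integrable_poissonKer hη).const_mul (∫ y, w y ^ 2)).mono'
        hms.norm.prod_swap.integral_prod_right' (Eventually.of_forall fun r => ?_)
      simp only [Function.uncurry_apply_pair, norm_mul]
      rw [integral_mul_const, Real.norm_of_nonneg (poissonKer_nonneg hη r), Real.norm_of_nonneg
        (mul_nonneg (integral_nonneg fun y => by positivity) (poissonKer_nonneg hη r))]
      refine mul_le_mul_of_nonneg_right ?_ (poissonKer_nonneg hη r)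
      simpa only [abs_mul, Real.norm_eq_abs] using integral_mul_shift_le h2 r
  have e : ∀ y, ∫ z, w y * w z * poissonKer η (y - z) =
      ∫ r, w y * w (y - r) * poissonKer η r := by
    intro y
    rw [← integral_sub_left_eq_self (fun z => w y * w z * poissonKer η (y - z)) volume y]
    simp only [sub_sub_cancel]
  simp only [e]
  rw [integral_integral_swap hint]
  calc ∫ r, ∫ y, w y * w (y - r) * poissonKer η r
      ≤ ∫ r, (∫ y, w y ^ 2) * poissonKer η r := by
        refine integral_mono hint.integral_prod_right
          ((integrable_poissonKer hη).const_mul _) fun r => ?_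
        simp only
        rw [integral_mul_const]
        refine mul_le_mul_of_nonneg_right ?_ (poissonKer_nonneg hη r)
        refine le_trans ?_ (integral_mul_shift_le h2 r)
        exact (le_abs_self _).trans (abs_integral_le_integral_abs)
    _ = ∫ y, w y ^ 2 := by rw [integral_const_mul, integral_poissonKer hη, mul_one]

/-- Absolute convergence rests on `w ∈ L¹` together with the kernel being in `L²`: the `x`-integral
is bounded uniformly in the pair `p`. -/
theorem integrable_conjConv_triple {η : ℝ} (hη : 0 < η) {w : ℝ → ℝ} (hm : Measurable w)
    (h1 : Integrable w) :
    Integrable (Function.uncurry fun (x : ℝ) (p : ℝ × ℝ) =>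
      (conjKernel η (x - p.1) * w p.1) * (conjKernel η (x - p.2) * w p.2))
      (volume.prod (volume.prod volume)) := by
  have hQ := (continuous_conjKernel hη).measurable
  have hms : AEStronglyMeasurable (Function.uncurry fun (x : ℝ) (p : ℝ × ℝ) =>
      (conjKernel η (x - p.1) * w p.1) * (conjKernel η (x - p.2) * w p.2))
      (volume.prod (volume.prod volume)) := by
    refine Measurable.aestronglyMeasurable ?_
    simp only [Function.uncurry_def]
    fun_prop
  have hQQ : ∀ p : ℝ × ℝ, Integrable fun x => conjKernel η (x - p.1) * conjKernel η (x - p.2) :=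
    fun p => (MemLp.comp_sub_right_two (memLp_conjKernel hη) p.1).integrable_mul (q := 2)
      (MemLp.comp_sub_right_two (memLp_conjKernel hη) p.2)
  have e : ∀ (x : ℝ) (p : ℝ × ℝ),
      (conjKernel η (x - p.1) * w p.1) * (conjKernel η (x - p.2) * w p.2) =
      (w p.1 * w p.2) * (conjKernel η (x - p.1) * conjKernel η (x - p.2)) := fun x p => by ring
  rw [integrable_prod_iff' hms]
  refine ⟨Eventually.of_forall fun p => ?_, ?_⟩
  · simp only [Function.uncurry_apply_pair, e]
    exact (hQQ p).const_mul _
  · refine ((h1.mul_prod h1).norm.mul_const (∫ x, conjKernel η x ^ 2)).mono'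
      hms.norm.prod_swap.integral_prod_right' (Eventually.of_forall fun p => ?_)
    simp only [Function.uncurry_apply_pair, e]
    rw [Real.norm_of_nonneg (integral_nonneg fun x => norm_nonneg _)]
    simp only [norm_mul (w p.1 * w p.2)]
    rw [integral_const_mul]
    refine mul_le_mul_of_nonneg_left ?_ (norm_nonneg _)
    have hi1 := (MemLp.comp_sub_right_two (memLp_conjKernel hη) p.1).integrable_sq
    have hi2 := (MemLp.comp_sub_right_two (memLp_conjKernel hη) p.2).integrable_sq
    calc ∫ x, ‖conjKernel η (x - p.1) * conjKernel η (x - p.2)‖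
        ≤ ∫ x, (conjKernel η (x - p.1) ^ 2 + conjKernel η (x - p.2) ^ 2) / 2 :=
          integral_mono (hQQ p).norm ((hi1.add hi2).div_const 2) fun x => abs_mul_le_half_sq _ _
      _ = ∫ x, conjKernel η x ^ 2 := by
          rw [integral_div, integral_add hi1 hi2,
            integral_sub_right_eq_self (fun x => conjKernel η x ^ 2),
            integral_sub_right_eq_self (fun x => conjKernel η x ^ 2)]
          ring

theorem conjConv_sq_eq (η : ℝ) (w : ℝ → ℝ) (x : ℝ) :
    conjConv η w x ^ 2 = ∫ p : ℝ × ℝ,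
      (conjKernel η (x - p.1) * w p.1) * (conjKernel η (x - p.2) * w p.2)
        ∂(volume.prod volume) := by
  rw [integral_prod_mul (fun y => conjKernel η (x - y) * w y)
    (fun y => conjKernel η (x - y) * w y), conjConv_eq, sq]

theorem integrable_conjConv_sq {η : ℝ} (hη : 0 < η) {w : ℝ → ℝ} (hm : Measurable w)
    (h1 : Integrable w) : Integrable fun x => conjConv η w x ^ 2 := by
  simp only [conjConv_sq_eq]
  exact (integrable_conjConv_triple hη hm h1).integral_prod_left

/-- A `T T*` argument: expand the square as a double integral and integrate in `x` first. Off the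
diagonal the two conjugate kernels combine into the Poisson kernel at height `2η`. -/
theorem integral_conjConv_sq_le {η : ℝ} (hη : 0 < η) {w : ℝ → ℝ} (hm : Measurable w)
    (h1 : Integrable w) (h2 : MemLp w 2 volume) :
    ∫ x, conjConv η w x ^ 2 ≤ ∫ y, w y ^ 2 := by
  have hint := integrable_conjConv_triple hη hm h1
  refine le_trans (le_of_eq ?_) (integral_poissonKer_bilinear_le (η := 2 * η) (by positivity) hm h2)
  simp only [conjConv_sq_eq]
  have hright : Integrable (fun p : ℝ × ℝ => ∫ x,
      (conjKernel η (x - p.1) * w p.1) * (conjKernel η (x - p.2) * w p.2))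
      (volume.prod volume) := hint.integral_prod_right
  rw [integral_integral_swap hint, integral_prod _ hright]
  refine integral_congr_ae (Eventually.of_forall fun y => integral_congr_ae ?_)
  have hne : ∀ᵐ z : ℝ, z ≠ y := by simp [ae_iff, measure_singleton]
  filter_upwards [hne] with z hz
  rw [← integral_conjKernel_sub_mul hη hz.symm, ← integral_const_mul]
  refine integral_congr_ae (Eventually.of_forall fun x => ?_)
  simp only
  ring

theorem measurable_conjConv {η : ℝ} (hη : 0 < η) {w : ℝ → ℝ} (hm : Measurable w) :
    StronglyMeasurable (conjConv η w) := by
  have hQ := (continuous_conjKernel hη).measurable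
  refine StronglyMeasurable.integral_prod_right
    (f := fun x s => conjKernel η s * w (x - s)) (Measurable.stronglyMeasurable ?_)
  simp only [Function.uncurry_def]
  fun_prop

theorem conjConv_congr_ae {η : ℝ} {w w' : ℝ → ℝ} (h : w =ᵐ[volume] w') :
    conjConv η w = conjConv η w' := by
  funext x
  rw [conjConv_eq, conjConv_eq]
  refine integral_congr_ae ?_
  filter_upwards [h] with y hy
  rw [hy]

/-- Integrability of `w` is removed by cutting off to `[-n, n]`: the convolutions converge
pointwise, and Fatou's lemma passes the bound to the limit. -/
theorem eLpNorm_conjConv_le {η : ℝ} (hη : 0 < η) {w : ℝ → ℝ} (hm : Measurable w)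
    (h2 : MemLp w 2 volume) : eLpNorm (conjConv η w) 2 volume ≤ eLpNorm w 2 volume := by
  set W : ℕ → ℝ → ℝ := fun n => (Icc (-(n : ℝ)) n).indicator w with hW
  have hWm : ∀ n, Measurable (W n) := fun n => hm.indicator measurableSet_Icc
  have hW2 : ∀ n, MemLp (W n) 2 volume := fun n => h2.indicator measurableSet_Icc
  have hW1 : ∀ n, Integrable (W n) := fun n =>
    (integrable_indicator_iff measurableSet_Icc).2
      ((h2.restrict _).integrable (by norm_num))
  have hWle : ∀ n x, |W n x| ≤ |w x| := fun n x => norm_indicator_le_norm_self w x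
  have hlim : ∀ x, Tendsto (fun n => W n x) atTop (𝓝 (w x)) := by
    intro x
    refine tendsto_const_nhds.congr' ?_
    filter_upwards [eventually_ge_atTop ⌈|x|⌉₊] with n hn
    have : |x| ≤ n := (Nat.le_ceil _).trans (by exact_mod_cast hn)
    have hx : x ∈ Icc (-(n : ℝ)) n := abs_le.1 this
    simp only [hW, indicator_of_mem hx]
  have hnorm : ∀ n, eLpNorm (conjConv η (W n)) 2 volume ≤ eLpNorm w 2 volume := by
    intro n
    refine le_trans ?_ (eLpNorm_mono (fun x => norm_indicator_le_norm_self w x) :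
      eLpNorm (W n) 2 volume ≤ eLpNorm w 2 volume)
    have hc2 : MemLp (conjConv η (W n)) 2 volume :=
      (memLp_two_iff_integrable_sq (measurable_conjConv hη (hWm n)).aestronglyMeasurable).2
        (integrable_conjConv_sq hη (hWm n) (hW1 n))
    have h := integral_conjConv_sq_le hη (hWm n) (hW1 n) (hW2 n)
    rw [← L2.norm_toLp_sq hc2, ← L2.norm_toLp_sq (hW2 n)] at h
    have h' := le_of_sq_le_sq h (norm_nonneg _)
    rw [Lp.norm_toLp, Lp.norm_toLp] at h'
    exact (ENNReal.toReal_le_toReal hc2.2.ne (hW2 n).2.ne).1 h'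
  have hF : ∀ x, Tendsto (fun n => conjConv η (W n) x) atTop (𝓝 (conjConv η w x)) := by
    intro x
    refine tendsto_integral_of_dominated_convergence (fun s => |conjKernel η s * w (x - s)|)
      (fun n => (integrable_conjKernel_mul hη (hW2 n) x).aestronglyMeasurable)
      (integrable_conjKernel_mul hη h2 x).abs
      (fun n => Eventually.of_forall fun s => ?_)
      (Eventually.of_forall fun s => (hlim (x - s)).const_mul _)
    rw [Real.norm_eq_abs, abs_mul, abs_mul]
    exact mul_le_mul_of_nonneg_left (hWle n _) (abs_nonneg _)
  refine (Lp.eLpNorm_lim_le_liminf_eLpNorm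
    (fun n => (measurable_conjConv hη (hWm n)).aestronglyMeasurable) (conjConv η w)
    (Eventually.of_forall hF)).trans ?_
  exact liminf_le_of_le (by isBoundedDefault) fun b hb => by
    obtain ⟨n, hn⟩ := hb.exists
    exact hn.trans (hnorm n)

/-! ### Convolution with the conjugate Poisson kernel on `L²` -/

theorem L2.measurable (w : L2) : Measurable w := (Lp.stronglyMeasurable w).measurable

theorem memLp_conjConv {η : ℝ} (hη : 0 < η) (w : L2) : MemLp (conjConv η w) 2 volume :=
  ⟨(measurable_conjConv hη (L2.measurable w)).aestronglyMeasurable,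
    (eLpNorm_conjConv_le hη (L2.measurable w) (Lp.memLp w)).trans_lt (Lp.memLp w).2⟩

theorem norm_toLp_conjConv_le {η : ℝ} (hη : 0 < η) (w : L2) :
    ‖(memLp_conjConv hη w).toLp _‖ ≤ ‖w‖ := by
  rw [Lp.norm_toLp, Lp.norm_def]
  exact ENNReal.toReal_mono (Lp.memLp w).2.ne
    (eLpNorm_conjConv_le hη (L2.measurable w) (Lp.memLp w))

theorem conjConv_add {η : ℝ} (hη : 0 < η) (v w : L2) :
    conjConv η (v + w : L2) = conjConv η v + conjConv η w := by
  rw [conjConv_congr_ae (Lp.coeFn_add v w)]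
  funext x
  rw [Pi.add_apply, conjConv, conjConv, conjConv,
    ← integral_add (integrable_conjKernel_mul hη (Lp.memLp v) x)
      (integrable_conjKernel_mul hη (Lp.memLp w) x)]
  simp only [Pi.add_apply, mul_add]

theorem conjConv_smul {η : ℝ} (c : ℝ) (w : L2) :
    conjConv η (c • w : L2) = c • conjConv η w := by
  rw [conjConv_congr_ae (Lp.coeFn_smul c w)]
  funext x
  rw [Pi.smul_apply, conjConv, conjConv, smul_eq_mul, ← integral_const_mul]
  simp only [Pi.smul_apply, smul_eq_mul, mul_left_comm]

/-- Convolution with the conjugate Poisson kernel, as a contraction of `L²`. -/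
noncomputable def conjL {η : ℝ} (hη : 0 < η) : L2 →L[ℝ] L2 :=
  LinearMap.mkContinuous
    { toFun := fun w => (memLp_conjConv hη w).toLp _
      map_add' := fun v w => by
        rw [← MemLp.toLp_add]
        exact MemLp.toLp_congr _ _ (EventuallyEq.of_eq (conjConv_add hη v w))
      map_smul' := fun c w => by
        rw [RingHom.id_apply, ← MemLp.toLp_const_smul]
        exact MemLp.toLp_congr _ _ (EventuallyEq.of_eq (conjConv_smul c w)) }
    1 fun w => by simpa using norm_toLp_conjConv_le hη w

theorem coeFn_conjL {η : ℝ} (hη : 0 < η) (w : L2) : conjL hη w =ᵐ[volume] conjConv η w :=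
  (memLp_conjConv hη w).coeFn_toLp

theorem norm_conjL_le {η : ℝ} (hη : 0 < η) (w : L2) : ‖conjL hη w‖ ≤ ‖w‖ :=
  norm_toLp_conjConv_le hη w

/-- Fubini turns the pairing into a superposition of pairings with translates of `w`, so the weak
derivative can be taken translate by translate. -/
theorem integral_conjConv_mul {η : ℝ} (hη : 0 < η) (w : L2) {ψ : ℝ → ℝ} (hψ : Continuous ψ)
    (hs : HasCompactSupport ψ) :
    ∫ x, conjConv η w x * ψ x = ∫ s, conjKernel η s * ∫ x, w (x - s) * ψ x := by
  have hQ := (continuous_conjKernel hη).measurable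
  have hw := L2.measurable w
  have hms : AEStronglyMeasurable
      (Function.uncurry fun x s => conjKernel η s * w (x - s) * ψ x) (volume.prod volume) := by
    refine Measurable.aestronglyMeasurable ?_
    have := hψ.measurable
    simp only [Function.uncurry_def]
    fun_prop
  have hQ2 := (memLp_conjKernel hη).integrable_sq
  have hw2 := L2.integrable_sq w
  have hint : Integrable (Function.uncurry fun x s => conjKernel η s * w (x - s) * ψ x)
      (volume.prod volume) := by
    rw [integrable_prod_iff hms]
    refine ⟨Eventually.of_forall fun x => ?_, ?_⟩
    · exact (integrable_conjKernel_mul hη (Lp.memLp w) x).mul_const (ψ x)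
    · refine ((hψ.integrable_of_hasCompactSupport hs).norm.const_mul
        (((∫ s, conjKernel η s ^ 2) + ∫ s, w s ^ 2) / 2)).mono'
        hms.norm.integral_prod_right' (Eventually.of_forall fun x => ?_)
      rw [Real.norm_of_nonneg (integral_nonneg fun s => norm_nonneg _)]
      simp only [Function.uncurry_apply_pair, norm_mul _ (ψ x)]
      rw [integral_mul_const]
      refine mul_le_mul_of_nonneg_right ?_ (norm_nonneg _)
      have hw2' := (MemLp.comp_sub_left_two (Lp.memLp w) x).integrable_sq
      calc ∫ s, ‖conjKernel η s * w (x - s)‖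
          ≤ ∫ s, (conjKernel η s ^ 2 + w (x - s) ^ 2) / 2 :=
            integral_mono (integrable_conjKernel_mul hη (Lp.memLp w) x).norm
              ((hQ2.add hw2').div_const 2) fun s => abs_mul_le_half_sq _ _
        _ = _ := by
            rw [integral_div, integral_add hQ2 hw2',
              integral_sub_left_eq_self (fun s => w s ^ 2)]
  have e : ∀ x, conjConv η w x * ψ x = ∫ s, conjKernel η s * w (x - s) * ψ x := fun x => by
    rw [integral_mul_const]; rfl
  simp only [e]
  rw [integral_integral_swap hint]
  simp only [mul_assoc, integral_const_mul]

theorem IsWeakDeriv.comp_sub_right {f g : ℝ → ℝ} (h : IsWeakDeriv f g) (s : ℝ) :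
    IsWeakDeriv (fun x => f (x - s)) fun x => g (x - s) := by
  intro φ hφ hs
  have h1 : ∫ x, f (x - s) * deriv φ x = ∫ x, f x * deriv (fun y => φ (y + s)) x := by
    rw [← integral_sub_right_eq_self (fun x => f x * deriv (fun y => φ (y + s)) x) s]
    simp only [deriv_comp_add_const, sub_add_cancel]
  have h2 : ∫ x, g (x - s) * φ x = ∫ x, g x * φ (x + s) := by
    rw [← integral_sub_right_eq_self (fun x => g x * φ (x + s)) s]
    simp only [sub_add_cancel]
  rw [h1, h2]
  exact h _ (hφ.comp (contDiff_id.add contDiff_const))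
    (hs.comp_homeomorph (Homeomorph.addRight s))

theorem isWeakDeriv_conjL {η : ℝ} (hη : 0 < η) (w : H1) :
    IsWeakDeriv (conjL hη w.fn) (conjL hη w.dx) := by
  refine IsWeakDeriv.congr_ae ?_ (coeFn_conjL hη w.fn).symm (coeFn_conjL hη w.dx).symm
  intro φ hφ hs
  rw [integral_conjConv_mul hη w.fn (hφ.continuous_deriv (by simp)) hs.deriv,
    integral_conjConv_mul hη w.dx hφ.continuous hs, ← integral_neg]
  refine integral_congr_ae (Eventually.of_forall fun s => ?_)
  simp only
  rw [w.isWeakDeriv.comp_sub_right s φ hφ hs]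
  ring

/-! ### Weak limits of contractions -/

/-- Bounded real families converge along an ultrafilter, so the forms `⟨T n f, g⟩` have a bounded
bilinear limit, represented by an operator through Riesz. No subsequence has to be extracted. -/
theorem exists_ultrafilter_weak_limit {E : Type*} [NormedAddCommGroup E] [InnerProductSpace ℝ E]
    [CompleteSpace E] {ι : Type*} (𝓤 : Ultrafilter ι) (T : ι → E →L[ℝ] E)
    (hT : ∀ n f, ‖T n f‖ ≤ ‖f‖) :
    ∃ S : E →L[ℝ] E, (∀ f, ‖S f‖ ≤ ‖f‖) ∧
      ∀ f g, Tendsto (fun n => inner ℝ (T n f) g) 𝓤 (𝓝 (inner ℝ (S f) g)) := by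
  have hbd : ∀ f g n, |inner ℝ (T n f) g| ≤ ‖f‖ * ‖g‖ := fun f g n =>
    (abs_real_inner_le_norm _ _).trans (mul_le_mul_of_nonneg_right (hT n f) (norm_nonneg _))
  have hlim : ∀ f g, ∃ c, |c| ≤ ‖f‖ * ‖g‖ ∧
      Tendsto (fun n => inner ℝ (T n f) g) 𝓤 (𝓝 c) := by
    intro f g
    have hmem : Icc (-(‖f‖ * ‖g‖)) (‖f‖ * ‖g‖) ∈
        𝓤.map (fun n => inner ℝ (T n f) g) :=
      Filter.Eventually.of_forall (f := (𝓤 : Filter ι)) fun n => abs_le.1 (hbd f g n)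
    obtain ⟨c, hc, hle⟩ := isCompact_Icc.ultrafilter_le_nhds' _ hmem
    exact ⟨c, abs_le.2 hc, hle⟩
  choose B hBle hB using hlim
  let F : E → E →L[ℝ] ℝ := fun f => LinearMap.mkContinuous
    { toFun := fun g => B f g
      map_add' := fun g h => tendsto_nhds_unique (hB f (g + h)) (by
        simpa only [inner_add_right] using (hB f g).add (hB f h))
      map_smul' := fun c g => tendsto_nhds_unique (hB f (c • g)) (by
        simpa only [inner_smul_right, smul_eq_mul, RingHom.id_apply] using
          (hB f g).const_mul c) } ‖f‖ fun g => hBle f g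
  let S : E → E := fun f => (InnerProductSpace.toDual ℝ E).symm (F f)
  have hS : ∀ f g, inner ℝ (S f) g = B f g := fun f g =>
    InnerProductSpace.toDual_symm_apply
  have hadd : ∀ f g, S (f + g) = S f + S g := fun f g => ext_inner_right ℝ fun h => by
    rw [inner_add_left, hS, hS, hS]
    refine tendsto_nhds_unique (hB (f + g) h) ?_
    simpa only [map_add, inner_add_left] using (hB f h).add (hB g h)
  have hsmul : ∀ (c : ℝ) f, S (c • f) = c • S f := fun c f => ext_inner_right ℝ fun h => by
    rw [real_inner_smul_left, hS, hS]
    refine tendsto_nhds_unique (hB (c • f) h) ?_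
    simpa only [map_smul, real_inner_smul_left] using (hB f h).const_mul c
  have hle : ∀ f, ‖S f‖ ≤ ‖f‖ := by
    intro f
    rcases (norm_nonneg (S f)).eq_or_lt with h | h
    · rw [← h]; exact norm_nonneg _
    · refine le_of_mul_le_mul_right ?_ h
      rw [← real_inner_self_eq_norm_mul_norm, hS]
      exact (le_abs_self _).trans (hBle _ _)
  refine ⟨LinearMap.mkContinuous { toFun := S, map_add' := hadd, map_smul' := hsmul } 1
    (by simpa using hle), hle, fun f g => ?_⟩
  change Tendsto _ _ (𝓝 (inner ℝ (S f) g))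
  rw [hS]
  exact hB f g

/-! ### The principal value for functions in `H¹` -/

/-- The symmetrized integrand of the principal value integral. -/
noncomputable def pvKernel (f : H1) (x s : ℝ) : ℝ := (f.rep (x - s) - f.rep (x + s)) / s

/-- The principal value `(1/π) P.V. ∫ f(y) / (x - y) dy`. -/
noncomputable def pvIntegral (f : H1) (x : ℝ) : ℝ := (2 * Real.pi)⁻¹ * ∫ s, pvKernel f x s

/-- An integrable majorant of `pvKernel f x`. -/
noncomputable def pvBound (f : H1) (x s : ℝ) : ℝ :=
  2 * ‖f.dx‖ * (Icc (-1 : ℝ) 1).indicator (fun s => |s| ^ (-(1 / 2) : ℝ)) s +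
    (f.rep (x - s) ^ 2 + f.rep (x + s) ^ 2 + 2 * (1 + s ^ 2)⁻¹)

theorem measurable_pvKernel (f : H1) : Measurable (Function.uncurry (pvKernel f)) := by
  have := f.continuous_rep.measurable
  unfold pvKernel
  simp only [Function.uncurry_def]
  fun_prop

theorem integrable_indicator_abs_rpow :
    Integrable ((Icc (-1 : ℝ) 1).indicator fun s => |s| ^ (-(1 / 2) : ℝ)) := by
  rw [integrable_indicator_iff measurableSet_Icc]
  have h1 : IntegrableOn (fun s : ℝ => |s| ^ (-(1 / 2) : ℝ)) (Ioc 0 1) := by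
    have h := (intervalIntegral.intervalIntegrable_rpow' (a := 0) (b := 1)
      (r := -(1 / 2)) (by norm_num)).1
    exact h.congr_fun (fun s hs => by simp only [abs_of_pos hs.1]) measurableSet_Ioc
  have h2 : IntegrableOn (fun s : ℝ => |s| ^ (-(1 / 2) : ℝ)) (Icc 0 1) := by
    rwa [integrableOn_Icc_iff_integrableOn_Ioc]
  have h3 : IntegrableOn (fun s : ℝ => |s| ^ (-(1 / 2) : ℝ)) (Icc (-1) 0) := by
    have h := (Measure.measurePreserving_neg (volume : Measure ℝ)).integrableOn_comp_preimage
      (Homeomorph.neg ℝ).measurableEmbedding (f := fun s : ℝ => |s| ^ (-(1 / 2) : ℝ))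
      (s := Icc 0 1)
    have h' := h.2 h2
    simpa [Function.comp_def] using h'
  have := h3.union h2
  rwa [Icc_union_Icc_eq_Icc (by norm_num) (by norm_num)] at this

theorem memLp_rep_add (f : H1) (x : ℝ) : MemLp (fun s => f.rep (x + s)) 2 volume :=
  f.memLp_rep.comp_measurePreserving (measurePreserving_add_left volume x)

theorem memLp_rep_sub (f : H1) (x : ℝ) : MemLp (fun s => f.rep (x - s)) 2 volume :=
  MemLp.comp_sub_left_two f.memLp_rep x

theorem integrable_pvBound (f : H1) (x : ℝ) : Integrable (pvBound f x) :=
  (integrable_indicator_abs_rpow.const_mul _).add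
    (((memLp_rep_sub f x).integrable_sq.add (memLp_rep_add f x).integrable_sq).add
      (integrable_inv_one_add_sq.const_mul 2))

/-- Translation invariance makes the dominating integral independent of `x`; hence the uniform bound
in `abs_conjConv_le`. -/
theorem integral_pvBound (f : H1) (x : ℝ) : ∫ s, pvBound f x s = ∫ s, pvBound f 0 s := by
  have h : ∀ x, ∫ s, pvBound f x s =
      2 * ‖f.dx‖ * (∫ s, (Icc (-1 : ℝ) 1).indicator (fun s => |s| ^ (-(1 / 2) : ℝ)) s) +
      (((∫ s, f.rep s ^ 2) + ∫ s, f.rep s ^ 2) + 2 * ∫ s : ℝ, (1 + s ^ 2)⁻¹) := by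
    intro x
    have h1 := (memLp_rep_sub f x).integrable_sq
    have h2 := (memLp_rep_add f x).integrable_sq
    have h12 : Integrable fun s => f.rep (x - s) ^ 2 + f.rep (x + s) ^ 2 := h1.add h2
    have h3 : Integrable fun s : ℝ => 2 * (1 + s ^ 2)⁻¹ := integrable_inv_one_add_sq.const_mul 2
    have h123 : Integrable fun s => f.rep (x - s) ^ 2 + f.rep (x + s) ^ 2 + 2 * (1 + s ^ 2)⁻¹ :=
      h12.add h3
    unfold pvBound
    rw [integral_add (integrable_indicator_abs_rpow.const_mul _) h123,
      integral_add h12 h3, integral_add h1 h2, integral_const_mul, integral_const_mul,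
      integral_sub_left_eq_self (fun s => f.rep s ^ 2),
      integral_add_left_eq_self (fun s => f.rep s ^ 2)]
  rw [h x, h 0]

/-- Near `s = 0` the Hölder-1/2 continuity of `f` leaves the integrable singularity `|s|^{-1/2}`.
For `|s| > 1`, the inequality `|ab| ≤ (a² + b²)/2` separates the values of `f` from `1/s`. -/
theorem abs_pvKernel_le (f : H1) (x s : ℝ) : |pvKernel f x s| ≤ pvBound f x s := by
  unfold pvKernel pvBound
  have hfar : 0 ≤ f.rep (x - s) ^ 2 + f.rep (x + s) ^ 2 + 2 * (1 + s ^ 2)⁻¹ := by positivity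
  rcases eq_or_ne s 0 with rfl | hs0
  · simp only [div_zero, abs_zero]
    refine add_nonneg (mul_nonneg (by positivity) (indicator_nonneg (fun s _ => by positivity) _))
      hfar
  by_cases hs : s ∈ Icc (-1 : ℝ) 1
  · rw [indicator_of_mem hs]
    refine le_add_of_le_of_nonneg ?_ hfar
    have habs : 0 < |s| := abs_pos.2 hs0
    have hdiff : |f.rep (x - s) - f.rep (x + s)| ≤ √(2 * |s|) * ‖f.dx‖ := by
      rcases le_or_gt 0 s with h | h
      · have := f.abs_rep_sub_le (show x - s ≤ x + s by linarith)
        rw [abs_sub_comm, abs_of_nonneg h]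
        convert this using 3
        ring
      · have := f.abs_rep_sub_le (show x + s ≤ x - s by linarith)
        rw [abs_of_neg h]
        convert this using 3
        ring
    have hpow : |s| ^ (-(1 / 2) : ℝ) = √|s| / |s| := by
      rw [Real.sqrt_eq_rpow, ← Real.rpow_sub_one habs.ne']
      norm_num
    rw [abs_div, hpow, mul_div_assoc']
    gcongr
    refine hdiff.trans ?_
    rw [Real.sqrt_mul zero_le_two]
    have h2 : √2 ≤ 2 := by
      rw [Real.sqrt_le_left (by norm_num)]
      norm_num
    have := mul_le_mul_of_nonneg_right h2 (mul_nonneg (Real.sqrt_nonneg |s|) (norm_nonneg f.dx))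
    linarith
  · rw [indicator_of_notMem hs, mul_zero, zero_add]
    have h1 : 1 ≤ s ^ 2 := by
      by_contra hc
      exact hs (abs_le.1 ((sq_le_one_iff_abs_le_one s).1 (not_le.1 hc).le))
    have hinv : (s⁻¹) ^ 2 ≤ 2 * (1 + s ^ 2)⁻¹ := by
      rw [inv_pow, ← div_eq_mul_inv, inv_eq_one_div, div_le_div_iff₀ (by positivity) (by positivity)]
      linarith
    have ha := abs_mul_le_half_sq (f.rep (x - s) - f.rep (x + s)) s⁻¹
    rw [← div_eq_mul_inv] at ha
    nlinarith [sq_nonneg (f.rep (x - s) + f.rep (x + s)), sq_nonneg (s⁻¹)]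

theorem integrable_pvKernel (f : H1) (x : ℝ) : Integrable (pvKernel f x) :=
  (integrable_pvBound f x).mono'
    ((measurable_pvKernel f).comp measurable_prodMk_left).aestronglyMeasurable
    (Eventually.of_forall (abs_pvKernel_le f x))

/-- Symmetrization: for an even weight, the integral against `f(x - s) / s` only sees the odd
part of `s ↦ f(x - s)`. -/
theorem integral_even_weight (f : H1) (x : ℝ) {k : ℝ → ℝ} (hk : ∀ s, k (-s) = k s)
    (hi : Integrable fun s => k s * (f.rep (x - s) / s)) :
    ∫ s, k s * (f.rep (x - s) / s) = 2⁻¹ * ∫ s, k s * pvKernel f x s := by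
  have h1 : ∫ s, k s * (f.rep (x - s) / s) = ∫ s, -(k s * (f.rep (x + s) / s)) := by
    rw [← integral_neg_eq_self (fun s => k s * (f.rep (x - s) / s))]
    refine integral_congr_ae (Eventually.of_forall fun s => ?_)
    simp only [hk, sub_neg_eq_add, div_neg, mul_neg]
  have hi' : Integrable fun s => -(k s * (f.rep (x + s) / s)) := by
    refine hi.comp_neg.congr (Eventually.of_forall fun s => ?_)
    simp only [hk, sub_neg_eq_add, div_neg, mul_neg]
  have h2 : ∫ s, k s * pvKernel f x s =
      (∫ s, k s * (f.rep (x - s) / s)) + ∫ s, -(k s * (f.rep (x + s) / s)) := by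
    rw [← integral_add hi hi']
    refine integral_congr_ae (Eventually.of_forall fun s => ?_)
    simp only [pvKernel]
    ring
  rw [h2, ← h1]
  ring

/-- The kernel is `1/(π s)` times the even weight `s²/(s² + η²)`, so only the odd part of `s ↦ f(x -
s)` survives. The weight tends to one as `η → 0`. -/
theorem conjConv_eq_pvKernel {η : ℝ} (hη : 0 < η) (f : H1) (x : ℝ) :
    conjConv η f.fn x =
      (2 * Real.pi)⁻¹ * ∫ s, s ^ 2 / (s ^ 2 + η ^ 2) * pvKernel f x s := by
  have e : ∀ s, conjKernel η s * f.rep (x - s) =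
      Real.pi⁻¹ * (s ^ 2 / (s ^ 2 + η ^ 2) * (f.rep (x - s) / s)) := by
    intro s
    unfold conjKernel
    rcases eq_or_ne s 0 with rfl | hs
    · simp
    · field_simp
  have hi : Integrable fun s => s ^ 2 / (s ^ 2 + η ^ 2) * (f.rep (x - s) / s) := by
    have := (integrable_conjKernel_mul hη f.memLp_rep x).const_mul Real.pi
    refine this.congr (Eventually.of_forall fun s => ?_)
    simp only [e]
    rw [mul_inv_cancel_left₀ Real.pi_ne_zero]
  rw [conjConv_congr_ae f.fn_ae_eq, conjConv]
  simp only [e]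
  rw [integral_const_mul, integral_even_weight f x (fun s => by rw [neg_sq]) hi]
  rw [mul_inv]
  ring

theorem ratio_le_one (η s : ℝ) : |s ^ 2 / (s ^ 2 + η ^ 2)| ≤ 1 := by
  rw [abs_of_nonneg (by positivity)]
  exact div_le_one_of_le₀ (by nlinarith [sq_nonneg η]) (by positivity)

theorem abs_conjConv_le {η : ℝ} (hη : 0 < η) (f : H1) (x : ℝ) :
    |conjConv η f.fn x| ≤ (2 * Real.pi)⁻¹ * ∫ s, pvBound f 0 s := by
  have hpi := Real.pi_pos
  rw [conjConv_eq_pvKernel hη, abs_mul, abs_of_pos (a := (2 * Real.pi)⁻¹) (by positivity),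
    ← integral_pvBound f x]
  gcongr
  rw [← Real.norm_eq_abs]
  refine norm_integral_le_of_norm_le (integrable_pvBound f x) (Eventually.of_forall fun s => ?_)
  rw [Real.norm_eq_abs, abs_mul]
  exact (mul_le_of_le_one_left (abs_nonneg _) (ratio_le_one η s)).trans (abs_pvKernel_le f x s)

theorem tendsto_conjConv (f : H1) (x : ℝ) {η : ℕ → ℝ} (hη : ∀ n, 0 < η n)
    (h0 : Tendsto η atTop (𝓝 0)) :
    Tendsto (fun n => conjConv (η n) f.fn x) atTop (𝓝 (pvIntegral f x)) := by
  simp only [fun n => conjConv_eq_pvKernel (hη n) f x]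
  refine Tendsto.const_mul _ (tendsto_integral_of_dominated_convergence (fun s => pvBound f x s)
    (fun n => ?_) (integrable_pvBound f x) (fun n => Eventually.of_forall fun s => ?_) ?_)
  · exact (Measurable.aestronglyMeasurable (by fun_prop)).mul
      (integrable_pvKernel f x).aestronglyMeasurable
  · rw [Real.norm_eq_abs, abs_mul]
    exact (mul_le_of_le_one_left (abs_nonneg _) (ratio_le_one _ s)).trans (abs_pvKernel_le f x s)
  · refine Eventually.of_forall fun s => ?_
    rcases eq_or_ne s 0 with rfl | hs
    · simp [pvKernel]
    · have h : Tendsto (fun n => s ^ 2 / (s ^ 2 + η n ^ 2)) atTop (𝓝 (s ^ 2 / (s ^ 2 + 0 ^ 2))) :=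
        tendsto_const_nhds.div (tendsto_const_nhds.add (h0.pow 2)) (by positivity)
      rw [zero_pow two_ne_zero, add_zero, div_self (pow_ne_zero 2 hs)] at h
      simpa using h.mul_const (pvKernel f x s)

/-- Cutting off `|s| ≤ ε` is again an even weight bounded by one, so the same symmetrization and the
same majorant apply. -/
theorem hasHilbertTransformAt_pvIntegral (f : H1) (x : ℝ) :
    HasHilbertTransformAt f.rep x (pvIntegral f x) := by
  unfold HasHilbertTransformAt
  have hm : ∀ ε : ℝ, MeasurableSet {s : ℝ | ε < |s|} := fun ε =>
    measurableSet_lt measurable_const (by fun_prop)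
  set k : ℝ → ℝ → ℝ := fun ε => {s : ℝ | ε < |s|}.indicator 1 with hk
  have hk1 : ∀ ε s, |k ε s| ≤ 1 := by
    intro ε s
    by_cases h : s ∈ {s : ℝ | ε < |s|}
    · simp [hk, indicator_of_mem h]
    · simp [hk, indicator_of_notMem h]
  have hkeven : ∀ ε s, k ε (-s) = k ε s := by
    intro ε s
    simp [hk, indicator]
  have hint : ∀ ε > 0, Integrable fun s => k ε s * (f.rep (x - s) / s) := by
    intro ε hε
    -- For `|s| > ε` one has `1/s² ≤ (1 + ε⁻²)/(1 + s²)`.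
    have hinv : MemLp (fun s : ℝ => k ε s * s⁻¹) 2 volume := by
      have hms : Measurable fun s : ℝ => k ε s * s⁻¹ :=
        (measurable_one.indicator (hm ε)).mul measurable_inv
      rw [memLp_two_iff_integrable_sq hms.aestronglyMeasurable]
      refine (integrable_inv_one_add_sq.const_mul (1 + (ε⁻¹) ^ 2)).mono'
        (hms.pow_const 2).aestronglyMeasurable (Eventually.of_forall fun s => ?_)
      rw [Real.norm_of_nonneg (sq_nonneg _)]
      by_cases h : s ∈ {s : ℝ | ε < |s|}
      · have hs : ε < |s| := h
        have hs2 : ε ^ 2 ≤ s ^ 2 := by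
          rw [← sq_abs s]
          exact pow_le_pow_left₀ hε.le hs.le 2
        have hspos : 0 < s ^ 2 := lt_of_lt_of_le (by positivity) hs2
        simp only [hk, indicator_of_mem h, Pi.one_apply, one_mul]
        rw [inv_pow, inv_pow, ← div_eq_mul_inv, inv_eq_one_div,
          div_le_div_iff₀ hspos (by positivity)]
        have : 1 ≤ (ε ^ 2)⁻¹ * s ^ 2 := by
          rw [inv_mul_eq_div]
          exact (one_le_div (by positivity)).2 hs2
        linarith
      · simp only [hk, indicator_of_notMem h, zero_mul, ne_eq, OfNat.ofNat_ne_zero,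
          not_false_eq_true, zero_pow]
        positivity
    have := hinv.integrable_mul (q := 2) (memLp_rep_sub f x)
    refine this.congr (Eventually.of_forall fun s => ?_)
    simp only [Pi.mul_apply]
    ring
  have e : ∀ ε > 0, (1 / Real.pi) * ∫ y in {y : ℝ | ε < |x - y|}, f.rep y / (x - y) =
      (2 * Real.pi)⁻¹ * ∫ s, k ε s * pvKernel f x s := by
    intro ε hε
    have hmx : MeasurableSet {y : ℝ | ε < |x - y|} := measurableSet_lt measurable_const (by fun_prop)
    rw [← integral_indicator hmx, ← integral_sub_left_eq_self _ volume x]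
    have e1 : ∀ s, {y : ℝ | ε < |x - y|}.indicator (fun y => f.rep y / (x - y)) (x - s) =
        k ε s * (f.rep (x - s) / s) := by
      intro s
      by_cases h : ε < |s|
      · simp [hk, indicator, h]
      · simp [hk, indicator, h]
    simp only [e1]
    rw [integral_even_weight f x (hkeven ε) (hint ε hε), mul_inv]
    ring
  have hlim : Tendsto (fun ε => (2 * Real.pi)⁻¹ * ∫ s, k ε s * pvKernel f x s) (𝓝[>] 0)
      (𝓝 (pvIntegral f x)) := by
    refine Tendsto.const_mul _ (tendsto_integral_filter_of_dominated_convergence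
      (fun s => pvBound f x s) (Eventually.of_forall fun ε => ?_)
      (Eventually.of_forall fun ε => Eventually.of_forall fun s => ?_) (integrable_pvBound f x) ?_)
    · exact (measurable_one.indicator (hm ε)).aestronglyMeasurable.mul
        (integrable_pvKernel f x).aestronglyMeasurable
    · rw [Real.norm_eq_abs, abs_mul]
      exact (mul_le_of_le_one_left (abs_nonneg _) (hk1 ε s)).trans (abs_pvKernel_le f x s)
    · refine Eventually.of_forall fun s => ?_
      refine tendsto_const_nhds.congr' ?_
      rcases eq_or_ne s 0 with rfl | hs
      · exact Eventually.of_forall fun ε => by simp [pvKernel]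
      · have : ∀ᶠ ε in 𝓝[>] (0 : ℝ), ε < |s| :=
          nhdsWithin_le_nhds (eventually_lt_nhds (abs_pos.2 hs))
        filter_upwards [this] with ε hε
        have hmem : s ∈ {s : ℝ | ε < |s|} := hε
        simp only [hk, indicator_of_mem hmem, Pi.one_apply, one_mul]
  refine hlim.congr' ?_
  filter_upwards [self_mem_nhdsWithin] with ε hε
  exact (e ε hε).symm

theorem HasHilbertTransformAt.congr_ae {f g : ℝ → ℝ} {x c : ℝ} (h : HasHilbertTransformAt f x c)
    (hfg : f =ᵐ[volume] g) : HasHilbertTransformAt g x c := by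
  unfold HasHilbertTransformAt at h ⊢
  refine h.congr fun ε => ?_
  congr 1
  refine integral_congr_ae ?_
  filter_upwards [ae_restrict_of_ae hfg] with y hy
  rw [hy]

/-! ### The Hilbert transform on `H¹` -/

theorem measurable_pvIntegral (f : H1) : Measurable (pvIntegral f) :=
  (StronglyMeasurable.integral_prod_right
    (measurable_pvKernel f).stronglyMeasurable).measurable.const_mul _

/-- The Hilbert transform as a bounded operator on `L²` which is given on `H¹` by the principal
value and which commutes with the weak derivative. -/
theorem exists_hilbertL2 : ∃ S : L2 →L[ℝ] L2, (∀ f, ‖S f‖ ≤ ‖f‖) ∧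
    (∀ f : H1, IsWeakDeriv (S f.fn) (S f.dx)) ∧ ∀ f : H1, S f.fn =ᵐ[volume] pvIntegral f := by
  have hη : ∀ n : ℕ, 0 < 1 / ((n : ℝ) + 1) := fun n => by positivity
  obtain ⟨S, hS, hlim⟩ := exists_ultrafilter_weak_limit (hyperfilter ℕ) (fun n => conjL (hη n))
    fun n => norm_conjL_le (hη n)
  have hle : (hyperfilter ℕ : Filter ℕ) ≤ atTop := Nat.hyperfilter_le_atTop
  have htest : ∀ (g : L2) {ψ : ℝ → ℝ}, Continuous ψ → HasCompactSupport ψ →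
      Tendsto (fun n => ∫ x, conjL (hη n) g x * ψ x) (hyperfilter ℕ) (𝓝 (∫ x, S g x * ψ x)) := by
    intro g ψ hψ hs
    have hm : MemLp ψ 2 volume := hψ.memLp_of_hasCompactSupport hs
    have e : ∀ h : L2, ∫ x, h x * ψ x = inner ℝ h (hm.toLp ψ) := by
      intro h
      rw [L2.inner_eq]
      refine integral_congr_ae ?_
      filter_upwards [hm.coeFn_toLp] with x hx
      rw [hx]
    simp only [e]
    exact hlim g _
  refine ⟨S, hS, fun f φ hφ hs => ?_, fun f => ?_⟩
  -- Both sides of the weak derivative identity for `conjL` converge along the ultrafilter.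
  · refine tendsto_nhds_unique (htest f.fn (hφ.continuous_deriv (by simp)) hs.deriv) ?_
    refine (htest f.dx hφ.continuous hs).neg.congr fun n => ?_
    exact (isWeakDeriv_conjL (hη n) f φ hφ hs).symm
  · set C := (2 * Real.pi)⁻¹ * ∫ s, pvBound f 0 s with hC
    have hpt : ∀ x, Tendsto (fun n : ℕ => conjConv (1 / ((n : ℝ) + 1)) f.fn x) atTop
        (𝓝 (pvIntegral f x)) := fun x =>
      tendsto_conjConv f x hη tendsto_one_div_add_atTop_nhds_zero_nat
    have hbd : ∀ x, |pvIntegral f x| ≤ C := fun x =>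
      le_of_tendsto (hpt x).abs (Eventually.of_forall fun n => abs_conjConv_le (hη n) f x)
    have hloc : LocallyIntegrable (pvIntegral f) volume :=
      (locallyIntegrable_const C).mono (measurable_pvIntegral f).aestronglyMeasurable
        (Eventually.of_forall fun x => (hbd x).trans (le_abs_self C))
    -- Against each test function, the weak limit along the ultrafilter and the pointwise limit
    -- along `atTop` must agree, since the hyperfilter is finer than `atTop`. The uniform constant
    -- `C` supplies the domination.
    refine ae_eq_of_integral_contDiff_smul_eq (L2.locallyIntegrable _) hloc fun ψ hψ hs => ?_
    simp only [smul_eq_mul, mul_comm (ψ _)]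
    refine tendsto_nhds_unique (htest f.fn hψ.continuous hs) (Tendsto.mono_left ?_ hle)
    refine tendsto_integral_of_dominated_convergence (fun x => C * |ψ x|) (fun n => ?_)
      ((hψ.continuous.integrable_of_hasCompactSupport hs).abs.const_mul C) (fun n => ?_) ?_
    · exact (Lp.aestronglyMeasurable _).mul hψ.continuous.aestronglyMeasurable
    · filter_upwards [coeFn_conjL (hη n) f.fn] with x hx
      rw [hx, Real.norm_eq_abs, abs_mul]
      exact mul_le_mul_of_nonneg_right (abs_conjConv_le (hη n) f x) (abs_nonneg _)
    · filter_upwards [ae_all_iff.2 fun n => coeFn_conjL (hη n) f.fn] with x hx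
      simp only [hx]
      exact (hpt x).mul_const _

/-- The Hilbert transform on `L²`. -/
noncomputable def hilbertL2 : L2 →L[ℝ] L2 := exists_hilbertL2.choose

theorem norm_hilbertL2_le (f : L2) : ‖hilbertL2 f‖ ≤ ‖f‖ := exists_hilbertL2.choose_spec.1 f

/-- The Hilbert transform on `H¹`. -/
noncomputable def hilbertH1 : H1 →L[ℝ] H1 :=
  LinearMap.mkContinuous
    { toFun := fun f => H1.mk (hilbertL2 f.fn) (hilbertL2 f.dx) (exists_hilbertL2.choose_spec.2.1 f)
      map_add' := fun f g => by
        refine Subtype.ext (WithLp.ofLp_injective 2 (Prod.ext ?_ ?_))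
        · exact map_add hilbertL2 f.fn g.fn
        · exact map_add hilbertL2 f.dx g.dx
      map_smul' := fun c f => by
        refine Subtype.ext (WithLp.ofLp_injective 2 (Prod.ext ?_ ?_))
        · exact map_smul hilbertL2 c f.fn
        · exact map_smul hilbertL2 c f.dx }
    2 fun f => by
      refine (H1.norm_le _).trans ?_
      have h1 := norm_hilbertL2_le f.fn
      have h2 := norm_hilbertL2_le f.dx
      have h3 := f.norm_fn_le
      have h4 := f.norm_dx_le
      exact (add_le_add (h1.trans h3) (h2.trans h4)).trans_eq (two_mul _).symm

theorem norm_fn_hilbertH1_le (f : H1) : ‖(hilbertH1 f).fn‖ ≤ ‖f.fn‖ := norm_hilbertL2_le f.fn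

theorem norm_dx_hilbertH1_le (f : H1) : ‖(hilbertH1 f).dx‖ ≤ ‖f.dx‖ := norm_hilbertL2_le f.dx

theorem hasHilbertTransformAt_hilbertH1 (f : H1) :
    ∀ᵐ x, HasHilbertTransformAt f.rep x ((hilbertH1 f).fn x) := by
  have h : (hilbertH1 f).fn =ᵐ[volume] pvIntegral f := exists_hilbertL2.choose_spec.2.2 f
  filter_upwards [h] with x hx
  rw [hx]
  exact hasHilbertTransformAt_pvIntegral f x

/-! ### Global solutions of autonomous equations from an a priori bound -/

section ODE

open Metric
open scoped NNReal

variable {E : Type*} [NormedAddCommGroup E] [NormedSpace ℝ E]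

theorem hasDerivWithinAt_Ici_of_Icc {f : ℝ → E} {f' : E} {a b t : ℝ} (ht : t ∈ Ico a b)
    (h : HasDerivWithinAt f f' (Icc a b) t) : HasDerivWithinAt f f' (Ici t) t :=
  (h.mono (Icc_subset_Icc_left ht.1)).mono_of_mem_nhdsWithin (Icc_mem_nhdsGE ht.2)

theorem exists_norm_le_of_hasDerivWithinAt {f f' : ℝ → E} {a b : ℝ}
    (h : ∀ t ∈ Icc a b, HasDerivWithinAt f (f' t) (Icc a b) t) :
    ∃ R, ∀ t ∈ Icc a b, ‖f t‖ ≤ R :=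
  isCompact_Icc.exists_bound_of_continuousOn fun t ht => (h t ht).continuousWithinAt

theorem eqOn_Icc_of_locallyLipschitz {F : E → E}
    (hF : ∀ R : ℝ, ∃ K : ℝ≥0, LipschitzOnWith K F (closedBall 0 R)) {T : ℝ} {γ γ' : ℝ → E}
    (h : ∀ t ∈ Icc 0 T, HasDerivWithinAt γ (F (γ t)) (Icc 0 T) t)
    (h' : ∀ t ∈ Icc 0 T, HasDerivWithinAt γ' (F (γ' t)) (Icc 0 T) t) (h0 : γ 0 = γ' 0) :
    EqOn γ γ' (Icc 0 T) := by
  obtain ⟨R, hR⟩ := exists_norm_le_of_hasDerivWithinAt h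
  obtain ⟨R', hR'⟩ := exists_norm_le_of_hasDerivWithinAt h'
  obtain ⟨K, hK⟩ := hF (max R R')
  refine ODE_solution_unique_of_mem_Icc_right (v := fun _ => F)
    (s := fun _ => closedBall 0 (max R R')) (K := K) (fun t _ => hK)
    (fun t ht => (h t ht).continuousWithinAt)
    (fun t ht => hasDerivWithinAt_Ici_of_Icc ht (h t (Ico_subset_Icc_self ht)))
    (fun t ht => ?_) (fun t ht => (h' t ht).continuousWithinAt)
    (fun t ht => hasDerivWithinAt_Ici_of_Icc ht (h' t (Ico_subset_Icc_self ht)))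
    (fun t ht => ?_) h0
  · exact mem_closedBall_zero_iff.2 ((hR t (Ico_subset_Icc_self ht)).trans (le_max_left _ _))
  · exact mem_closedBall_zero_iff.2 ((hR' t (Ico_subset_Icc_self ht)).trans (le_max_right _ _))

/-- The radial retraction onto the closed ball of radius `R`. -/
noncomputable def radialRetraction (R : ℝ) (x : E) : E := (R / max R ‖x‖) • x

theorem radialRetraction_of_le {R : ℝ} (hR : 0 < R) {x : E} (hx : ‖x‖ ≤ R) :
    radialRetraction R x = x := by
  rw [radialRetraction, max_eq_left hx, div_self hR.ne', one_smul]

theorem norm_radialRetraction_le {R : ℝ} (hR : 0 < R) (x : E) : ‖radialRetraction R x‖ ≤ R := by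
  have hm : 0 < max R ‖x‖ := lt_max_of_lt_left hR
  rw [radialRetraction, norm_smul, Real.norm_of_nonneg (by positivity), div_mul_eq_mul_div,
    div_le_iff₀ hm]
  exact mul_le_mul_of_nonneg_left (le_max_right _ _) hR.le

theorem lipschitzWith_radialRetraction {R : ℝ} (hR : 0 < R) :
    LipschitzWith 2 (radialRetraction R : E → E) := by
  refine LipschitzWith.of_dist_le_mul fun x y => ?_
  rw [dist_eq_norm, dist_eq_norm, NNReal.coe_ofNat]
  have ha : 0 < max R ‖x‖ := lt_max_of_lt_left hR
  have hb : 0 < max R ‖y‖ := lt_max_of_lt_left hR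
  -- One term moves the point at a fixed scaling factor, the other changes the factor. Each has norm
  -- at most `‖x - y‖`, hence the Lipschitz constant `2`.
  have e : radialRetraction R x - radialRetraction R y =
      (R / max R ‖x‖) • (x - y) +
        ((R / max R ‖x‖) * ((max R ‖y‖ - max R ‖x‖) / max R ‖y‖)) • y := by
    have hc : (R / max R ‖x‖) * ((max R ‖y‖ - max R ‖x‖) / max R ‖y‖) =
        R / max R ‖x‖ - R / max R ‖y‖ := by
      field_simp
    rw [hc, sub_smul, smul_sub, radialRetraction, radialRetraction]
    abel
  have h1 : R / max R ‖x‖ ≤ 1 := (div_le_one ha).2 (le_max_left _ _)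
  have h2 : |max R ‖y‖ - max R ‖x‖| ≤ ‖x - y‖ := by
    refine (abs_max_sub_max_le_max R ‖y‖ R ‖x‖).trans ?_
    rw [sub_self, abs_zero, max_eq_right (abs_nonneg _), norm_sub_rev]
    exact abs_norm_sub_norm_le y x
  have h3 : ‖y‖ / max R ‖y‖ ≤ 1 := (div_le_one hb).2 (le_max_right _ _)
  have h4 : ‖((R / max R ‖x‖) * ((max R ‖y‖ - max R ‖x‖) / max R ‖y‖)) • y‖ ≤ ‖x - y‖ := by
    rw [norm_smul, Real.norm_eq_abs, abs_mul, abs_div, abs_div, abs_of_pos hR, abs_of_pos ha,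
      abs_of_pos hb]
    calc R / max R ‖x‖ * (|max R ‖y‖ - max R ‖x‖| / max R ‖y‖) * ‖y‖
        = (R / max R ‖x‖) * (‖y‖ / max R ‖y‖) * |max R ‖y‖ - max R ‖x‖| := by ring
      _ ≤ 1 * 1 * ‖x - y‖ := by gcongr
      _ = ‖x - y‖ := by ring
  have h5 : ‖(R / max R ‖x‖) • (x - y)‖ ≤ ‖x - y‖ := by
    rw [norm_smul, Real.norm_of_nonneg (by positivity)]
    exact mul_le_of_le_one_left (norm_nonneg _) h1
  rw [e]
  linarith [norm_add_le ((R / max R ‖x‖) • (x - y))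
    (((R / max R ‖x‖) * ((max R ‖y‖ - max R ‖x‖) / max R ‖y‖)) • y)]

/-- A solution of the equation with truncated right hand side stays where nothing is truncated. -/
theorem norm_le_of_truncated_solution {F : E → E} {x₀ : E} {C : ℝ}
    (hapriori : ∀ T ≥ 0, ∀ γ : ℝ → E, γ 0 = x₀ →
      (∀ t ∈ Icc 0 T, HasDerivWithinAt γ (F (γ t)) (Icc 0 T) t) → ∀ t ∈ Icc 0 T, ‖γ t‖ ≤ C)
    {R : ℝ} (hR : 0 < R) (hCR : C < R) {T : ℝ} {γ : ℝ → E} (h0 : γ 0 = x₀)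
    (hγ : ∀ t ∈ Icc 0 T, HasDerivWithinAt γ (F (radialRetraction R (γ t))) (Icc 0 T) t) :
    ∀ t ∈ Icc 0 T, ‖γ t‖ < R := by
  have hcont : ContinuousOn (fun t => ‖γ t‖) (Icc 0 T) := fun t ht =>
    (hγ t ht).continuousWithinAt.norm
  -- As long as the curve has stayed in the ball of radius `R` it solves the original equation, so
  -- the a priori bound `C < R` applies. At the first time when the norm reaches `R` this is a
  -- contradiction.
  have hkey : ∀ τ ∈ Icc 0 T, (∀ t ∈ Icc 0 τ, ‖γ t‖ ≤ R) → ‖γ τ‖ ≤ C := by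
    intro τ hτ hle
    refine hapriori τ hτ.1 γ h0 (fun t ht => ?_) τ (right_mem_Icc.2 hτ.1)
    have := (hγ t ⟨ht.1, ht.2.trans hτ.2⟩).mono (Icc_subset_Icc_right hτ.2)
    rwa [radialRetraction_of_le hR (hle t ht)] at this
  have hx₀ : ‖γ 0‖ ≤ C := by
    refine hapriori 0 le_rfl γ h0 (fun t ht => ?_) 0 (by simp)
    rw [Icc_self, mem_singleton_iff] at ht
    rw [Icc_self, ht]
    exact hasDerivWithinAt_iff_hasFDerivWithinAt.2 HasFDerivWithinAt.singleton
  by_contra! hc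
  obtain ⟨t₁, ht₁, hbig⟩ := hc
  set S := Icc 0 T ∩ (fun t => ‖γ t‖) ⁻¹' Ici R with hS
  have hSclosed : IsClosed S := hcont.preimage_isClosed_of_isClosed isClosed_Icc isClosed_Ici
  have hSne : S.Nonempty := ⟨t₁, ht₁, hbig⟩
  have hSbdd : BddBelow S := ⟨0, fun t ht => ht.1.1⟩
  have hmem : sInf S ∈ S := hSclosed.csInf_mem hSne hSbdd
  set τ := sInf S with hτ
  have hlt : ∀ t ∈ Ico 0 τ, ‖γ t‖ < R := by
    intro t ht
    by_contra hc
    exact absurd (csInf_le hSbdd ⟨⟨ht.1, ht.2.le.trans hmem.1.2⟩, not_lt.1 hc⟩) (not_le.2 ht.2)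
  have hτ0 : 0 < τ := by
    refine lt_of_le_of_ne hmem.1.1 fun h => ?_
    have : R ≤ ‖γ τ‖ := hmem.2
    rw [← h] at this
    linarith
  have hτR : ‖γ τ‖ ≤ R := by
    have hcl : τ ∈ closure (Ico 0 τ) := by
      rw [closure_Ico hτ0.ne]
      exact right_mem_Icc.2 hτ0.le
    have hτc := (hcont τ hmem.1).mono (Ico_subset_Icc_self.trans (Icc_subset_Icc_right hmem.1.2))
    have := mem_closure_iff_nhdsWithin_neBot.1 hcl
    exact le_of_tendsto hτc (eventually_mem_nhdsWithin.mono fun t ht => (hlt t ht).le)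
  have h1 := hkey τ hmem.1 fun t ht => by
    rcases ht.2.lt_or_eq with h | h
    · exact (hlt t ⟨ht.1, h⟩).le
    · rw [h]; exact hτR
  have h2 : R ≤ ‖γ τ‖ := hmem.2
  linarith

variable [CompleteSpace E]

/-- A field bounded by `L` moves a point by at most `L T` in time `T`, so Picard–Lindelöf on the
ball of that radius covers `[0, T]` in one step. -/
theorem exists_solution_Icc_of_lipschitz_bounded {G : E → E} {K L : ℝ≥0} (hK : LipschitzWith K G)
    (hL : ∀ x, ‖G x‖ ≤ L) (x₀ : E) {T : ℝ} (hT : 0 ≤ T) :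
    ∃ γ : ℝ → E, γ 0 = x₀ ∧ ∀ t ∈ Icc 0 T, HasDerivWithinAt γ (G (γ t)) (Icc 0 T) t := by
  have hp : IsPicardLindelof (fun _ => G) (⟨0, left_mem_Icc.2 hT⟩ : Icc (0 : ℝ) T) x₀
      (L * T.toNNReal) 0 L K :=
    { lipschitzOnWith := fun _ _ => hK.lipschitzOnWith
      continuousOn := fun _ _ => continuousOn_const
      norm_le := fun _ _ x _ => hL x
      mul_max_le := by simp [hT] }
  exact hp.exists_eq_forall_mem_Icc_hasDerivWithinAt₀

/-- The field is precomposed with the retraction onto a ball of radius `R > C`, which makes it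
globally Lipschitz and bounded. Its solutions on `[0, n]` never feel the truncation, and uniqueness
glues them. Maximal solutions and blow-up criteria are not needed. -/
theorem exists_solution_Ici_of_apriori {F : E → E}
    (hF : ∀ R : ℝ, ∃ K : ℝ≥0, LipschitzOnWith K F (closedBall 0 R)) {x₀ : E} {C : ℝ}
    (hapriori : ∀ T ≥ 0, ∀ γ : ℝ → E, γ 0 = x₀ →
      (∀ t ∈ Icc 0 T, HasDerivWithinAt γ (F (γ t)) (Icc 0 T) t) → ∀ t ∈ Icc 0 T, ‖γ t‖ ≤ C) :
    ∃ γ : ℝ → E, γ 0 = x₀ ∧ ∀ t ∈ Ici (0 : ℝ), HasDerivWithinAt γ (F (γ t)) (Ici 0) t := by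
  set R := max C 0 + 1 with hRdef
  have hR : 0 < R := by positivity
  have hCR : C < R := (le_max_left C 0).trans_lt (lt_add_one _)
  obtain ⟨K, hK⟩ := hF R
  have hmaps : ∀ x : E, radialRetraction R x ∈ closedBall (0 : E) R := fun x =>
    mem_closedBall_zero_iff.2 (norm_radialRetraction_le hR x)
  have hG : LipschitzWith (K * 2) fun x : E => F (radialRetraction R x) := by
    rw [← lipschitzOnWith_univ]
    exact hK.comp (lipschitzWith_radialRetraction hR).lipschitzOnWith fun x _ => hmaps x
  have hGb : ∀ x : E, ‖F (radialRetraction R x)‖ ≤ (‖F 0‖₊ + K * R.toNNReal : ℝ≥0) := by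
    intro x
    have h1 := hK.dist_le_mul _ (hmaps x) 0 (mem_closedBall_self hR.le)
    rw [dist_eq_norm, dist_zero_right] at h1
    have h2 := mul_le_mul_of_nonneg_left (norm_radialRetraction_le hR x) K.coe_nonneg
    have h3 := norm_le_norm_add_norm_sub (F 0) (F (radialRetraction R x))
    rw [norm_sub_rev] at h3
    simp only [NNReal.coe_add, coe_nnnorm, NNReal.coe_mul, Real.coe_toNNReal _ hR.le]
    linarith
  have hsol : ∀ n : ℕ, ∃ γ : ℝ → E, γ 0 = x₀ ∧
      ∀ t ∈ Icc (0 : ℝ) n, HasDerivWithinAt γ (F (γ t)) (Icc (0 : ℝ) n) t := by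
    intro n
    obtain ⟨γ, h0, hγ⟩ := exists_solution_Icc_of_lipschitz_bounded hG hGb x₀ n.cast_nonneg
    refine ⟨γ, h0, fun t ht => ?_⟩
    have := norm_le_of_truncated_solution hapriori hR hCR h0 hγ t ht
    have h := hγ t ht
    rwa [radialRetraction_of_le hR this.le] at h
  choose g hg0 hg using hsol
  have hcompat : ∀ m n : ℕ, m ≤ n → ∀ t ∈ Icc (0 : ℝ) m, g m t = g n t := by
    intro m n hmn
    have hsub : Icc (0 : ℝ) m ⊆ Icc 0 n := Icc_subset_Icc_right (by exact_mod_cast hmn)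
    exact eqOn_Icc_of_locallyLipschitz hF (hg m) (fun t ht => (hg n t (hsub ht)).mono hsub)
      ((hg0 m).trans (hg0 n).symm)
  -- The extra `1` keeps `t` strictly below the right end point, so that `[0, N]` is a neighbourhood
  -- of `t` within `[0, ∞)`.
  set γ : ℝ → E := fun t => g (⌈t⌉₊ + 1) t with hγ
  have hmem : ∀ t ∈ Ici (0 : ℝ), t ∈ Ico (0 : ℝ) ((⌈t⌉₊ + 1 : ℕ) : ℝ) := fun t ht =>
    ⟨ht, (Nat.le_ceil t).trans_lt (by push_cast; linarith)⟩
  have hγeq : ∀ n : ℕ, ∀ t ∈ Icc (0 : ℝ) n, γ t = g n t := by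
    intro n t ht
    rcases le_total (⌈t⌉₊ + 1) n with h | h
    · exact hcompat _ _ h t (Ico_subset_Icc_self (hmem t ht.1))
    · exact (hcompat _ _ h t ht).symm
  refine ⟨γ, hg0 _, fun t ht => ?_⟩
  have hIco := hmem t ht
  set N := ⌈t⌉₊ + 1 with hN
  have h := (hg N t (Ico_subset_Icc_self hIco)).congr (hγeq N)
    (hγeq N t (Ico_subset_Icc_self hIco))
  rw [← hγeq N t (Ico_subset_Icc_self hIco)] at h
  refine h.mono_of_mem_nhdsWithin ?_
  rw [← Ici_inter_Iic]
  exact inter_mem self_mem_nhdsWithin (nhdsWithin_le_nhds (Iic_mem_nhds hIco.2))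

end ODE

/-! ### Functions in `H¹` supported in an interval -/

section Support

variable {f : H1} {a δ : ℝ}

theorem H1.rep_left_eq_zero (hf : ∀ x, x ∉ Icc a (a + δ) → f.rep x = 0) : f.rep a = 0 := by
  have h : EqOn f.rep (fun _ => 0) (Iio a) := fun x hx => hf x fun hc => not_lt.2 hc.1 hx
  have h' := h.closure f.continuous_rep continuous_const
  rw [closure_Iio] at h'
  exact h' self_mem_Iic

/-- By continuity `f` vanishes at the left end point, so `f(x)` is an integral of `f_x` over a
length at most `δ`. -/
theorem H1.abs_rep_le_of_support (hf : ∀ x, x ∉ Icc a (a + δ) → f.rep x = 0)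
    (x : ℝ) : |f.rep x| ≤ √δ * ‖f.dx‖ := by
  by_cases hx : x ∈ Icc a (a + δ)
  · have h := f.abs_rep_sub_le hx.1
    rw [H1.rep_left_eq_zero hf, sub_zero] at h
    refine h.trans (mul_le_mul_of_nonneg_right (Real.sqrt_le_sqrt ?_) (norm_nonneg _))
    linarith [hx.2]
  · rw [hf x hx, abs_zero]
    positivity

theorem H1.norm_fn_le_of_support (hδ : 0 ≤ δ) (hf : ∀ x, x ∉ Icc a (a + δ) → f.rep x = 0) :
    ‖f.fn‖ ≤ δ * ‖f.dx‖ := by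
  refine le_of_sq_le_sq ?_ (by positivity)
  have e : ∫ x, f.rep x ^ 2 = ∫ x in Icc a (a + δ), f.rep x ^ 2 := by
    rw [← integral_indicator measurableSet_Icc]
    refine integral_congr_ae (Eventually.of_forall fun x => ?_)
    by_cases hx : x ∈ Icc a (a + δ)
    · simp only [indicator_of_mem hx]
    · simp only [indicator_of_notMem hx, hf x hx, ne_eq, OfNat.ofNat_ne_zero, not_false_eq_true,
        zero_pow]
  rw [H1.norm_fn_sq, e]
  calc ∫ x in Icc a (a + δ), f.rep x ^ 2
      ≤ ∫ _ in Icc a (a + δ), (√δ * ‖f.dx‖) ^ 2 := by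
        refine setIntegral_mono_on f.memLp_rep.integrable_sq.integrableOn
          continuousOn_const.integrableOn_Icc measurableSet_Icc fun x _ => ?_
        rw [← sq_abs]
        exact pow_le_pow_left₀ (abs_nonneg _) (H1.abs_rep_le_of_support hf x) 2
    _ = (δ * ‖f.dx‖) ^ 2 := by
        simp only [setIntegral_const, measureReal_def, Real.volume_Icc, add_sub_cancel_left,
          ENNReal.toReal_ofReal hδ, smul_eq_mul, mul_pow, Real.sq_sqrt hδ]
        ring

theorem H1.dx_ae_eq_zero_of_support (hf : ∀ x, x ∉ Icc a (a + δ) → f.rep x = 0) :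
    ∀ᵐ x, x ∉ Icc a (a + δ) → f.dx x = 0 := by
  filter_upwards [ae_hasDerivAt_of_primitive (L2.locallyIntegrable f.dx) f.rep_sub] with x hx hxI
  have h0 : f.rep =ᶠ[𝓝 x] fun _ => 0 := by
    filter_upwards [isClosed_Icc.isOpen_compl.mem_nhds hxI] with y hy
    exact hf y hy
  exact hx.unique ((hasDerivAt_const x (0 : ℝ)).congr_of_eventuallyEq h0)

theorem H1.support_mul_self (hf : ∀ x, x ∉ Icc a (a + δ) → f.rep x = 0) :
    ∀ x, x ∉ Icc a (a + δ) → (f.mul f).rep x = 0 := fun x hx => by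
  simp only [H1.rep_mul, hf x hx, mul_zero]

theorem H1.norm_dx_mul_self_le (hf : ∀ x, x ∉ Icc a (a + δ) → f.rep x = 0) :
    ‖(f.mul f).dx‖ ≤ 2 * √δ * ‖f.dx‖ ^ 2 := by
  have h := f.norm_mulL2_le f.dx (H1.abs_rep_le_of_support hf)
  rw [H1.dx_mul]
  refine (norm_add_le _ _).trans ?_
  nlinarith

theorem norm_dx_hilbertH1_sq_le (hf : ∀ x, x ∉ Icc a (a + δ) → f.rep x = 0) :
    ‖(hilbertH1 (f.mul f)).dx‖ ≤ 2 * √δ * ‖f.dx‖ ^ 2 :=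
  (norm_dx_hilbertH1_le _).trans (H1.norm_dx_mul_self_le hf)

theorem norm_fn_hilbertH1_sq_le (hδ : 0 ≤ δ) (hf : ∀ x, x ∉ Icc a (a + δ) → f.rep x = 0) :
    ‖(hilbertH1 (f.mul f)).fn‖ ≤ δ * (2 * √δ * ‖f.dx‖ ^ 2) :=
  (norm_fn_hilbertH1_le _).trans ((H1.norm_fn_le_of_support hδ (H1.support_mul_self hf)).trans
    (mul_le_mul_of_nonneg_left (H1.norm_dx_mul_self_le hf) hδ))

/-- `H(u²)` is not supported in the interval, so the interpolation inequality with `l = δ` replaces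
the support argument; its two terms contribute `2δ` each. For `δ = 0` both norm bounds are zero. -/
theorem abs_rep_hilbertH1_sq_le (hδ : 0 ≤ δ) (hf : ∀ x, x ∉ Icc a (a + δ) → f.rep x = 0)
    (x : ℝ) : |(hilbertH1 (f.mul f)).rep x| ≤ 4 * δ * ‖f.dx‖ ^ 2 := by
  have h1 := norm_dx_hilbertH1_sq_le hf
  have h2 := norm_fn_hilbertH1_sq_le hδ hf
  rcases hδ.eq_or_lt with rfl | hpos
  · have := (hilbertH1 (f.mul f)).abs_rep_le x
    simp only [Real.sqrt_zero, mul_zero, zero_mul] at h1 h2 ⊢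
    linarith
  · have h3 := (hilbertH1 (f.mul f)).sqrt_mul_abs_rep_le hpos x
    have hs : 0 < √δ := Real.sqrt_pos.2 hpos
    refine le_of_mul_le_mul_left (h3.trans ?_) hs
    have := mul_le_mul_of_nonneg_left h1 hδ
    linarith

end Support

/-! ### A priori estimates -/

/-- The quadratic vector field of the system. -/
noncomputable def vectorField (p : H1 × H1) : H1 × H1 :=
  ((2 : ℝ) • p.1.mul p.2, hilbertH1 (p.1.mul p.1))

/-- A nondecreasing continuous quantity which cannot lie in `(k', k]` stays below `k'`. -/
theorem le_of_bootstrap {y : ℝ → ℝ} {T k k' : ℝ} (hk : k' < k) (hy : ContinuousOn y (Icc 0 T))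
    (hmono : MonotoneOn y (Icc 0 T)) (h0 : y 0 ≤ k')
    (h : ∀ t ∈ Icc 0 T, y t ≤ k → y t ≤ k') : ∀ t ∈ Icc 0 T, y t ≤ k' := by
  intro t ht
  by_contra! hc
  have hsub : Icc 0 t ⊆ Icc 0 T := Icc_subset_Icc_right ht.2
  have hmem : min k (y t) ∈ Icc (y 0) (y t) :=
    ⟨le_min (h0.trans hk.le) (hmono (left_mem_Icc.2 (ht.1.trans ht.2)) ht ht.1), min_le_right _ _⟩
  obtain ⟨s, hs, hse⟩ := intermediate_value_Icc ht.1 (hy.mono hsub) hmem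
  have h1 := h s (hsub hs) (hse ▸ min_le_left _ _)
  rw [hse] at h1
  exact absurd h1 (not_le.2 (lt_min hk hc))

/-- Exponential decay from a differential inequality with memory. -/
theorem decay_of_memory_inequality {D D' y : ℝ → ℝ} {T α δ : ℝ} (hδ : 0 ≤ δ)
    (hα : 0 ≤ α) (hsmall : α + 1 / 3 * δ * D 0 < 1 / 4) (hD0 : ∀ t ∈ Icc 0 T, 0 ≤ D t)
    (hD : ContinuousOn D (Icc 0 T)) (hy : ContinuousOn y (Icc 0 T)) (hy0 : y 0 = 0)
    (hD' : ∀ t ∈ Ico 0 T, HasDerivWithinAt D (D' t) (Ici t) t)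
    (hy' : ∀ t ∈ Ico 0 T, HasDerivWithinAt y (D t) (Ici t) t)
    (hineq : ∀ t ∈ Ico 0 T, D' t ≤ 4 * D t * (-3 + α + 6 * δ * y t)) :
    ∀ t ∈ Icc 0 T, 6 * δ * y t ≤ 9 / 16 ∧ 8 * y t ≤ D 0 ∧ D t ≤ D 0 * Real.exp (-8 * t) := by
  intro t₀ ht₀
  have h0T : (0 : ℝ) ∈ Icc 0 T := left_mem_Icc.2 (ht₀.1.trans ht₀.2)
  have hD00 := hD0 0 h0T
  have hmono : MonotoneOn y (Icc 0 T) := by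
    intro s hs t ht hst
    have hsub : Icc s t ⊆ Icc 0 T := Icc_subset_Icc hs.1 ht.2
    refine image_le_of_deriv_right_le_deriv_boundary (f := fun _ => y s) (f' := fun _ => 0)
      (B := y) (B' := D) continuousOn_const (fun x _ => hasDerivWithinAt_const _ _ _) le_rfl
      (hy.mono hsub) (fun x hx => hy' x ⟨hs.1.trans hx.1, hx.2.trans_le ht.2⟩)
      (fun x hx => hD0 x (hsub (Ico_subset_Icc_self hx))) (right_mem_Icc.2 hst)
  -- Smallness gives `α < 1/4`, so with `6δy ≤ 3/4` the bracket is at most `-2`. Then `D' ≤ -8D =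
  -- -8y'`, and `D + 8y` does not increase.
  have henergy : ∀ t ∈ Icc 0 T, 6 * δ * y t ≤ 3 / 4 → D t + 8 * y t ≤ D 0 := by
    intro t ht hyt
    have hsub : Icc 0 t ⊆ Icc 0 T := Icc_subset_Icc_right ht.2
    have hsub' : Ico 0 t ⊆ Ico 0 T := Ico_subset_Ico_right ht.2
    refine image_le_of_deriv_right_le_deriv_boundary (f := fun s => D s + 8 * y s)
      (f' := fun s => D' s + 8 * D s) (B := fun _ => D 0) (B' := fun _ => 0)
      ((hD.mono hsub).add ((hy.mono hsub).const_mul 8))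
      (fun x hx => (hD' x (hsub' hx)).add ((hy' x (hsub' hx)).const_mul 8))
      (by simp [hy0]) continuousOn_const (fun x _ => hasDerivWithinAt_const _ _ _)
      (fun x hx => ?_) (right_mem_Icc.2 ht.1)
    have hxI := hsub (Ico_subset_Icc_self hx)
    have h1 := hineq x (hsub' hx)
    have h2 : 6 * δ * y x ≤ 6 * δ * y t :=
      mul_le_mul_of_nonneg_left (hmono hxI ht hx.2.le) (by positivity)
    have h3 : 0 ≤ 1 / 3 * δ * D 0 := by positivity
    have h4 : 4 * D x * (-3 + α + 6 * δ * y x) ≤ 4 * D x * (-2) :=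
      mul_le_mul_of_nonneg_left (by linarith) (by linarith [hD0 x hxI])
    linarith
  -- From `8y ≤ D 0` and `δ D 0 < 3/4` one gets `6δy ≤ (6/8)(3/4) = 9/16`, strictly better than the
  -- assumed `3/4`.
  have hboot : ∀ t ∈ Icc 0 T, 6 * δ * y t ≤ 9 / 16 := by
    refine le_of_bootstrap (k := 3 / 4) (by norm_num) (hy.const_mul (6 * δ)) (fun s hs t ht hst =>
      mul_le_mul_of_nonneg_left (hmono hs ht hst) (by positivity)) (by simp [hy0]; norm_num) ?_
    intro t ht hyt
    have h1 := henergy t ht hyt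
    have h2 := hD0 t ht
    have h3 := mul_le_mul_of_nonneg_left (show 8 * y t ≤ D 0 by linarith) hδ
    linarith
  have hb := hboot t₀ ht₀
  refine ⟨hb, by linarith [henergy t₀ ht₀ (by linarith), hD0 t₀ ht₀], ?_⟩
  have hexp : D t₀ * Real.exp (8 * t₀) ≤ D 0 := by
    have hd : ∀ t, HasDerivAt (fun t : ℝ => Real.exp (8 * t)) (Real.exp (8 * t) * 8) t := by
      intro t
      simpa using ((hasDerivAt_id t).const_mul (8 : ℝ)).exp
    refine image_le_of_deriv_right_le_deriv_boundary (f := fun s => D s * Real.exp (8 * s))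
      (f' := fun s => D' s * Real.exp (8 * s) + D s * (Real.exp (8 * s) * 8))
      (B := fun _ => D 0) (B' := fun _ => 0)
      (hD.mul (by fun_prop)) (fun x hx => (hD' x hx).mul (hd x).hasDerivWithinAt) (by simp)
      continuousOn_const (fun x _ => hasDerivWithinAt_const _ _ _) (fun x hx => ?_) ht₀
    have h1 := hineq x hx
    have h2 := hboot x (Ico_subset_Icc_self hx)
    have h3 : 0 ≤ 1 / 3 * δ * D 0 := by positivity
    have h4 : 4 * D x * (-3 + α + 6 * δ * y x) ≤ 4 * D x * (-2) :=
      mul_le_mul_of_nonneg_left (by linarith) (by linarith [hD0 x (Ico_subset_Icc_self hx)])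
    have h5 : (D' x + 8 * D x) * Real.exp (8 * x) ≤ 0 :=
      mul_nonpos_of_nonpos_of_nonneg (by linarith) (Real.exp_pos _).le
    linarith
  rw [neg_mul, Real.exp_neg, ← div_eq_mul_inv, le_div_iff₀ (Real.exp_pos _)]
  exact hexp

section APriori

variable {γ : ℝ → H1 × H1} {T : ℝ}

theorem continuousOn_of_solution
    (hγ : ∀ t ∈ Icc 0 T, HasDerivWithinAt γ (vectorField (γ t)) (Icc 0 T) t) :
    ContinuousOn γ (Icc 0 T) := fun t ht => (hγ t ht).continuousWithinAt

theorem hasDerivWithinAt_fst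
    (hγ : ∀ t ∈ Icc 0 T, HasDerivWithinAt γ (vectorField (γ t)) (Icc 0 T) t) {F : Type*}
    [NormedAddCommGroup F] [NormedSpace ℝ F] (A : H1 →L[ℝ] F) (t : ℝ) (ht : t ∈ Ico 0 T) :
    HasDerivWithinAt (fun t => A (γ t).1) ((2 : ℝ) • A ((γ t).1.mul (γ t).2)) (Ici t) t := by
  have h := hasDerivWithinAt_Ici_of_Icc ht (hγ t (Ico_subset_Icc_self ht))
  have := (A.comp (ContinuousLinearMap.fst ℝ H1 H1)).hasFDerivAt.comp_hasDerivWithinAt t h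
  simpa [vectorField, Function.comp_def] using this

theorem hasDerivWithinAt_snd
    (hγ : ∀ t ∈ Icc 0 T, HasDerivWithinAt γ (vectorField (γ t)) (Icc 0 T) t) {F : Type*}
    [NormedAddCommGroup F] [NormedSpace ℝ F] (A : H1 →L[ℝ] F) (t : ℝ) (ht : t ∈ Ico 0 T) :
    HasDerivWithinAt (fun t => A (γ t).2) (A (hilbertH1 ((γ t).1.mul (γ t).1))) (Ici t) t := by
  have h := hasDerivWithinAt_Ici_of_Icc ht (hγ t (Ico_subset_Icc_self ht))
  have := (A.comp (ContinuousLinearMap.snd ℝ H1 H1)).hasFDerivAt.comp_hasDerivWithinAt t h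
  simpa [vectorField, Function.comp_def] using this

/-- The first component of a solution keeps its zeros. -/
theorem rep_fst_eq_zero
    (hγ : ∀ t ∈ Icc 0 T, HasDerivWithinAt γ (vectorField (γ t)) (Icc 0 T) t) {x : ℝ}
    (hx : (γ 0).1.rep x = 0) : ∀ t ∈ Icc 0 T, (γ t).1.rep x = 0 := by
  obtain ⟨R, hR⟩ := exists_norm_le_of_hasDerivWithinAt hγ
  have hc : ContinuousOn (fun t => (γ t).1.rep x) (Icc 0 T) :=
    (H1.evalL x).continuous.comp_continuousOn
      (continuous_fst.comp_continuousOn (continuousOn_of_solution hγ))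
  refine eq_zero_of_abs_deriv_le_mul_abs_self_of_eq_zero_right (K := 4 * R) hc
    (hasDerivWithinAt_fst hγ (H1.evalL x)) hx fun t ht => ?_
  have h1 := (γ t).2.abs_rep_le_norm x
  have h2 : ‖(γ t).2‖ ≤ R := (norm_snd_le _).trans (hR t (Ico_subset_Icc_self ht))
  rw [H1.evalL_apply, H1.rep_mul, smul_eq_mul, Real.norm_eq_abs, Real.norm_eq_abs, abs_mul,
    abs_mul, abs_two]
  nlinarith [mul_le_mul_of_nonneg_left (h1.trans (mul_le_mul_of_nonneg_left h2 zero_le_two))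
    (abs_nonneg ((γ t).1.rep x))]

/-- The Leibniz rule leaves `∫ v u_x²` and `∫ u u_x v_x`. Since `u_x` vanishes almost everywhere off
the interval, only the upper bound of `v` there matters; the second term uses `|u| ≤ √δ ‖u_x‖`. -/
theorem inner_dx_mul_le {u v : H1} {a δ m : ℝ} (hu : ∀ x, x ∉ Icc a (a + δ) → u.rep x = 0)
    (hv : ∀ᵐ x, x ∈ Icc a (a + δ) → v.rep x ≤ m) :
    inner ℝ u.dx (u.mul v).dx ≤ ‖u.dx‖ ^ 2 * (m + √δ * ‖v.dx‖) := by
  rw [H1.dx_mul, inner_add_right]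
  have h1 : inner ℝ u.dx (v.mulL2 u.dx) ≤ m * ‖u.dx‖ ^ 2 := by
    rw [L2.inner_eq, L2.norm_sq_eq, ← integral_const_mul]
    refine integral_mono_ae (L2.integrable_mul _ _) ((L2.integrable_sq _).const_mul m) ?_
    filter_upwards [hv, H1.dx_ae_eq_zero_of_support hu, v.coeFn_mulL2 u.dx] with x h1 h2 h3
    simp only [h3]
    by_cases hx : x ∈ Icc a (a + δ)
    · nlinarith [mul_le_mul_of_nonneg_right (h1 hx) (sq_nonneg (u.dx x))]
    · simp [h2 hx]
  have h2 : inner ℝ u.dx (u.mulL2 v.dx) ≤ ‖u.dx‖ * (√δ * ‖u.dx‖ * ‖v.dx‖) :=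
    (real_inner_le_norm _ _).trans (mul_le_mul_of_nonneg_left
      (u.norm_mulL2_le v.dx (H1.abs_rep_le_of_support hu)) (norm_nonneg _))
  linarith

theorem apriori_estimate {a δ : ℝ} (hδ : 0 ≤ δ) (hT : 0 ≤ T)
    (hγ : ∀ t ∈ Icc 0 T, HasDerivWithinAt γ (vectorField (γ t)) (Icc 0 T) t)
    (hsupp : ∀ x, x ∉ Icc a (a + δ) → (γ 0).1.rep x = 0)
    (hv₀ : ∀ᵐ x, x ∈ Icc a (a + δ) → (γ 0).2.rep x ≤ -3)
    (hsmall : √δ * (‖(γ 0).2.dx‖ + 1 / 3 * √δ * ‖(γ 0).1.dx‖ ^ 2) < 1 / 4) :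
    ∀ t ∈ Icc 0 T, (∀ x, x ∉ Icc a (a + δ) → (γ t).1.rep x = 0) ∧
      ‖(γ t).1.dx‖ ≤ ‖(γ 0).1.dx‖ * Real.exp (-4 * t) ∧
      ‖(γ t).2.dx‖ ≤ ‖(γ 0).2.dx‖ + √δ * ‖(γ 0).1.dx‖ ^ 2 ∧
      ‖(γ t).2.fn‖ ≤ ‖(γ 0).2.fn‖ + δ * √δ * ‖(γ 0).1.dx‖ ^ 2 := by
  have hss : √δ * √δ = δ := Real.mul_self_sqrt hδ
  have hS : ∀ t ∈ Icc 0 T, ∀ x, x ∉ Icc a (a + δ) → (γ t).1.rep x = 0 := fun t ht x hx =>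
    rep_fst_eq_zero hγ (hsupp x hx) t ht
  have hc := continuousOn_of_solution hγ
  set D : ℝ → ℝ := fun t => ‖(γ t).1.dx‖ ^ 2 with hDdef
  have hDc : ContinuousOn D (Icc 0 T) :=
    ((H1.dxL.continuous.comp_continuousOn (continuous_fst.comp_continuousOn hc)).norm).pow 2
  -- Extending `D` by constants beyond `[0, T]` gives a continuous integrand on the whole line, so
  -- `y` is differentiable everywhere.
  set E : ℝ → ℝ := fun t => D (projIcc 0 T hT t) with hE
  have hEc : Continuous E := hDc.domRestrict.comp continuous_projIcc
  have hED : ∀ t ∈ Icc 0 T, E t = D t := fun t ht => by rw [hE]; simp only [projIcc_of_mem hT ht]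
  set y : ℝ → ℝ := fun t => ∫ s in (0 : ℝ)..t, E s with hy
  have hyd : ∀ t, HasDerivAt y (E t) t := fun t => hEc.integral_hasStrictDerivAt 0 t |>.hasDerivAt
  have hyc : Continuous y := continuous_iff_continuousAt.2 fun t => (hyd t).continuousAt
  have hy0 : y 0 = 0 := intervalIntegral.integral_same
  have hyd' : ∀ t ∈ Ico 0 T, ∀ c e : ℝ,
      HasDerivWithinAt (fun t => c + e * y t) (e * D t) (Ici t) t := fun t ht c e => by
    rw [← hED t (Ico_subset_Icc_self ht)]
    exact (((hyd t).const_mul e).const_add c).hasDerivWithinAt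
  have hbc : ∀ c e : ℝ, ContinuousOn (fun t => c + e * y t) (Icc 0 T) := fun c e =>
    (continuous_const.add (continuous_const.mul hyc)).continuousOn
  have hsndc : ∀ {F : Type} [NormedAddCommGroup F] [NormedSpace ℝ F] (A : H1 →L[ℝ] F),
      ContinuousOn (fun t => A (γ t).2) (Icc 0 T) := fun A =>
    A.continuous.comp_continuousOn (continuous_snd.comp_continuousOn hc)
  have hvdx : ∀ t ∈ Icc 0 T, ‖(γ t).2.dx‖ ≤ ‖(γ 0).2.dx‖ + 2 * √δ * y t :=
    image_norm_le_of_norm_deriv_right_le_deriv_boundary' (hsndc H1.dxL)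
      (hasDerivWithinAt_snd hγ H1.dxL) (by simp [hy0]) (hbc _ _) (fun t ht => hyd' t ht _ _)
      fun t ht => norm_dx_hilbertH1_sq_le (hS t (Ico_subset_Icc_self ht))
  have hvfn : ∀ t ∈ Icc 0 T, ‖(γ t).2.fn‖ ≤ ‖(γ 0).2.fn‖ + δ * (2 * √δ) * y t :=
    image_norm_le_of_norm_deriv_right_le_deriv_boundary' (hsndc H1.fnL)
      (hasDerivWithinAt_snd hγ H1.fnL) (by simp [hy0]) (hbc _ _) (fun t ht => hyd' t ht _ _)
      fun t ht => (norm_fn_hilbertH1_sq_le hδ (hS t (Ico_subset_Icc_self ht))).trans_eq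
        (mul_assoc _ _ _).symm
  have hvrep : ∀ x, ∀ t ∈ Icc 0 T, (γ t).2.rep x ≤ (γ 0).2.rep x + 4 * δ * y t := fun x =>
    image_le_of_deriv_right_le_deriv_boundary (hsndc (H1.evalL x))
      (hasDerivWithinAt_snd hγ (H1.evalL x)) (by simp [hy0]) (hbc _ _) (fun t ht => hyd' t ht _ _)
      fun t ht => (le_abs_self _).trans
        (abs_rep_hilbertH1_sq_le hδ (hS t (Ico_subset_Icc_self ht)) x)
  have hdecay := decay_of_memory_inequality (D := D) (y := y) (T := T)
    (α := √δ * ‖(γ 0).2.dx‖) (δ := δ)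
    (D' := fun t => 2 * inner ℝ (γ t).1.dx ((2 : ℝ) • ((γ t).1.mul (γ t).2).dx))
    hδ (by positivity) (by
      have e : √δ * (‖(γ 0).2.dx‖ + 1 / 3 * √δ * ‖(γ 0).1.dx‖ ^ 2) =
        √δ * ‖(γ 0).2.dx‖ + 1 / 3 * (√δ * √δ) * ‖(γ 0).1.dx‖ ^ 2 := by ring
      rwa [e, hss] at hsmall) (fun t _ => sq_nonneg _) hDc hyc.continuousOn hy0
    (fun t ht => (hasDerivWithinAt_fst hγ H1.dxL t ht).norm_sq)
    (fun t ht => by simpa using hyd' t ht 0 1) (fun t ht => ?_)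
  · intro t ht
    obtain ⟨-, h2, h3⟩ := hdecay t ht
    have hD0 : D 0 = ‖(γ 0).1.dx‖ ^ 2 := rfl
    refine ⟨hS t ht, ?_, ?_, ?_⟩
    · refine le_of_sq_le_sq (h3.trans_eq ?_) (by positivity)
      rw [hD0, mul_pow, ← Real.exp_nat_mul]
      congr 2
      push_cast
      ring
    · refine (hvdx t ht).trans ?_
      have := mul_le_mul_of_nonneg_left h2 (Real.sqrt_nonneg δ)
      have h0 : 0 ≤ √δ * D 0 := mul_nonneg (Real.sqrt_nonneg δ) (sq_nonneg _)
      linarith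
    · refine (hvfn t ht).trans ?_
      have hp : 0 ≤ δ * √δ := by positivity
      have := mul_le_mul_of_nonneg_left h2 hp
      have h0 : 0 ≤ δ * √δ * D 0 := mul_nonneg hp (sq_nonneg _)
      linarith
  · have htI := Ico_subset_Icc_self ht
    have hm : ∀ᵐ x, x ∈ Icc a (a + δ) → (γ t).2.rep x ≤ -3 + 4 * δ * y t := by
      filter_upwards [hv₀] with x hx hxI
      linarith [hvrep x t htI, hx hxI]
    have h1 := inner_dx_mul_le (hS t htI) hm
    -- The memory coefficient `6δ` is assembled here: `4δ` from the pointwise growth of `v` and `2δ`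
    -- from `√δ` times the growth of `‖v_x‖`.
    have h2 := mul_le_mul_of_nonneg_left (hvdx t htI) (Real.sqrt_nonneg δ)
    have e : √δ * (‖(γ 0).2.dx‖ + 2 * √δ * y t) =
        √δ * ‖(γ 0).2.dx‖ + 2 * (√δ * √δ) * y t := by ring
    rw [e, hss] at h2
    have h3 := mul_le_mul_of_nonneg_left (add_le_add_right h2 (-3 + 4 * δ * y t))
      (sq_nonneg ‖(γ t).1.dx‖)
    simp only [inner_smul_right, hDdef]
    linarith

end APriori

/-! ### The system as an ordinary differential equation in `H¹ × H¹` -/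

theorem norm_hilbertH1_le (f : H1) : ‖hilbertH1 f‖ ≤ 2 * ‖f‖ := by
  have h := (hilbertH1 f).norm_le
  linarith [norm_fn_hilbertH1_le f, norm_dx_hilbertH1_le f, f.norm_fn_le, f.norm_dx_le]

theorem norm_mul_sub_mul_le {f g f' g' : H1} {R d : ℝ} (hg : ‖g‖ ≤ R) (hf' : ‖f'‖ ≤ R)
    (h1 : ‖f - f'‖ ≤ d) (h2 : ‖g - g'‖ ≤ d) : ‖f.mul g - f'.mul g'‖ ≤ 12 * R * d := by
  have e : f.mul g - f'.mul g' = (f - f').mul g + f'.mul (g - g') := by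
    simp only [← H1.mulL_apply, map_sub, sub_apply]
    abel
  have h3 := H1.norm_mul_le (f - f') g
  have h4 := H1.norm_mul_le f' (g - g')
  have h5 := mul_le_mul h1 hg (norm_nonneg _) ((norm_nonneg _).trans h1)
  have h6 := mul_le_mul hf' h2 (norm_nonneg _) ((norm_nonneg _).trans hf')
  rw [e]
  refine (norm_add_le _ _).trans ?_
  linarith

theorem exists_lipschitzOnWith_vectorField (R : ℝ) :
    ∃ K : NNReal, LipschitzOnWith K vectorField (Metric.closedBall 0 R) := by
  -- In both components a factor `2` (the coefficient in `2uv`, or the bound for `hilbertH1`)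
  -- multiplies the constant `12 R` of the product.
  refine ⟨(24 * R).toNNReal, LipschitzOnWith.of_dist_le_mul fun p hp q hq => ?_⟩
  rw [mem_closedBall_zero_iff] at hp hq
  have hR : 0 ≤ R := (norm_nonneg _).trans hp
  rw [dist_eq_norm, dist_eq_norm, Real.coe_toNNReal _ (by positivity)]
  have d1 : ‖p.1 - q.1‖ ≤ ‖p - q‖ := norm_fst_le (p - q)
  have d2 : ‖p.2 - q.2‖ ≤ ‖p - q‖ := norm_snd_le (p - q)
  have h1 := norm_mul_sub_mul_le ((norm_snd_le p).trans hp) ((norm_fst_le q).trans hq) d1 d2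
  have h2 := norm_mul_sub_mul_le ((norm_fst_le p).trans hp) ((norm_fst_le q).trans hq) d1 d1
  refine max_le ?_ ?_
  · change ‖(2 : ℝ) • p.1.mul p.2 - (2 : ℝ) • q.1.mul q.2‖ ≤ _
    rw [← smul_sub, norm_smul, Real.norm_of_nonneg zero_le_two]
    linarith
  · change ‖hilbertH1 (p.1.mul p.1) - hilbertH1 (q.1.mul q.1)‖ ≤ _
    rw [← map_sub]
    linarith [norm_hilbertH1_le (p.1.mul p.1 - q.1.mul q.1)]

theorem continuous_vectorField : Continuous vectorField := by
  have h1 : Continuous fun p : H1 × H1 => H1.mulL p.1 p.2 :=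
    (H1.mulL.continuous.comp continuous_fst).clm_apply continuous_snd
  have h2 : Continuous fun p : H1 × H1 => H1.mulL p.1 p.1 :=
    (H1.mulL.continuous.comp continuous_fst).clm_apply continuous_fst
  exact (h1.const_smul (2 : ℝ)).prodMk (hilbertH1.continuous.comp h2)

theorem H1.fn_two_smul_mul (f g : H1) :
    ((2 : ℝ) • f.mul g).fn =ᵐ[volume] fun x => 2 * f.fn x * g.fn x := by
  filter_upwards [Lp.coeFn_smul (2 : ℝ) (f.mul g).fn, f.coeFn_mulL2 g.fn, f.fn_ae_eq]
    with x h1 h2 h3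
  change ((2 : ℝ) • (f.mul g).fn : L2) x = _
  rw [h1, Pi.smul_apply, H1.fn_mul, h2, h3, smul_eq_mul, mul_assoc]

theorem hasHilbertTransformAt_sq (f : H1) :
    ∀ᵐ x, HasHilbertTransformAt (fun y => f.fn y ^ 2) x ((hilbertH1 (f.mul f)).fn x) := by
  filter_upwards [hasHilbertTransformAt_hilbertH1 (f.mul f)] with x hx
  refine hx.congr_ae ?_
  filter_upwards [f.fn_ae_eq] with y hy
  simp only [H1.rep_mul, hy, sq]

theorem contDiffOn_one_of_hasDerivWithinAt {E : Type*} [NormedAddCommGroup E] [NormedSpace ℝ E]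
    {f f' : ℝ → E} {s : Set ℝ} (hs : UniqueDiffOn ℝ s)
    (h : ∀ t ∈ s, HasDerivWithinAt f (f' t) s t) (hf' : ContinuousOn f' s) :
    ContDiffOn ℝ 1 f s :=
  (contDiffOn_one_iff_derivWithin hs).2 ⟨fun t ht => (h t ht).differentiableWithinAt,
    hf'.congr fun t ht => (h t ht).derivWithin (hs t ht)⟩

theorem isSolutionOn_of_hasDerivWithinAt {I : Set ℝ} (hI : UniqueDiffOn ℝ I) {u₀ v₀ : H1}
    {γ : ℝ → H1 × H1} (h0 : γ 0 = (u₀, v₀))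
    (hγ : ∀ t ∈ I, HasDerivWithinAt γ (vectorField (γ t)) I t) :
    IsSolutionOn I u₀ v₀ (fun t => (γ t).1) fun t => (γ t).2 := by
  have h1 : ∀ t ∈ I, HasDerivWithinAt (fun t => (γ t).1) (vectorField (γ t)).1 I t := fun t ht =>
    (ContinuousLinearMap.fst ℝ H1 H1).hasFDerivAt.comp_hasDerivWithinAt t (hγ t ht)
  have h2 : ∀ t ∈ I, HasDerivWithinAt (fun t => (γ t).2) (vectorField (γ t)).2 I t := fun t ht =>
    (ContinuousLinearMap.snd ℝ H1 H1).hasFDerivAt.comp_hasDerivWithinAt t (hγ t ht)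
  have hc : ContinuousOn (fun t => vectorField (γ t)) I :=
    continuous_vectorField.comp_continuousOn fun t ht => (hγ t ht).continuousWithinAt
  refine ⟨by rw [h0], by rw [h0],
    contDiffOn_one_of_hasDerivWithinAt hI h1 (continuous_fst.comp_continuousOn hc),
    contDiffOn_one_of_hasDerivWithinAt hI h2 (continuous_snd.comp_continuousOn hc),
    fun t ht => ?_, fun t ht => ?_⟩
  · rw [(h1 t ht).derivWithin (hI t ht)]
    exact (γ t).1.fn_two_smul_mul (γ t).2
  · rw [(h2 t ht).derivWithin (hI t ht)]
    exact hasHilbertTransformAt_sq (γ t).1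

/-- Identities almost everywhere determine the time derivatives as elements of `H1`, because
principal value limits are unique and elements of `H1` are determined by their functions. Uniqueness
for the ODE thus covers every solution. -/
theorem IsSolutionOn.hasDerivWithinAt {I : Set ℝ} {u₀ v₀ : H1} {u v : ℝ → H1}
    (h : IsSolutionOn I u₀ v₀ u v) :
    ∀ t ∈ I, HasDerivWithinAt (fun t => (u t, v t)) (vectorField (u t, v t)) I t := by
  intro t ht
  have h1 := (h.contDiffOn_u.differentiableOn one_ne_zero t ht).hasDerivWithinAt
  have h2 := (h.contDiffOn_v.differentiableOn one_ne_zero t ht).hasDerivWithinAt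
  have e1 : derivWithin u I t = (2 : ℝ) • (u t).mul (v t) := H1.ext_fn (by
    filter_upwards [h.eqn_u t ht, (u t).fn_two_smul_mul (v t)] with x hx hx'
    rw [hx, hx'])
  have e2 : derivWithin v I t = hilbertH1 ((u t).mul (u t)) := H1.ext_fn (by
    filter_upwards [h.eqn_v t ht, hasHilbertTransformAt_sq (u t)] with x hx hx'
    exact tendsto_nhds_unique hx hx')
  rw [e1] at h1
  rw [e2] at h2
  exact h1.prodMk h2

theorem H1.rep_eq_zero_of_ae {f : H1} {a b : ℝ} (h : ∀ᵐ x, x ∉ Icc a b → f.fn x = 0) :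
    ∀ x, x ∉ Icc a b → f.rep x = 0 := by
  have hae : f.rep =ᵐ[volume.restrict (Icc a b)ᶜ] fun _ => 0 := by
    refine (ae_restrict_iff' measurableSet_Icc.compl).2 ?_
    filter_upwards [h, f.fn_ae_eq] with x hx hx' hxI
    rw [← hx', hx hxI]
  exact Measure.eqOn_open_of_ae_eq hae isClosed_Icc.isOpen_compl f.continuous_rep.continuousOn
    continuousOn_const

end NonlocalSystem

/-! ### Global existence, uniqueness and decay. -/

theorem mainTheorem2 (u₀ v₀ : NonlocalSystem.H1) (a δ : ℝ) (hδ : 0 ≤ δ)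
    (hsupp : ∀ᵐ x, x ∉ Icc a (a + δ) → u₀.fn x = 0)
    (hv₀ : ∀ᵐ x, x ∈ Icc a (a + δ) → v₀.fn x ≤ -3)
    (hsmall : √δ * (‖v₀.dx‖ + 1 / 3 * √δ * ‖u₀.dx‖ ^ 2) < 1 / 4) :
    ∃ u v : ℝ → NonlocalSystem.H1,
      NonlocalSystem.IsSolutionOn (Ici 0) u₀ v₀ u v ∧
      (∀ T > 0, ∀ u' v' : ℝ → NonlocalSystem.H1,
        NonlocalSystem.IsSolutionOn (Ico 0 T) u₀ v₀ u' v' →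
          ∀ t ∈ Ico 0 T, u' t = u t ∧ v' t = v t) ∧
      (∃ M : ℝ, ∀ t ≥ 0, ‖u t‖ ≤ M ∧ ‖v t‖ ≤ M) ∧
      ∃ C : ℝ, ∀ t ≥ 0,
        eLpNorm (u t).fn ∞ volume ≤ ENNReal.ofReal (C * Real.exp (-3 * t)) ∧
        ‖u t‖ ≤ C * Real.exp (-3 * t) ∧
        ‖v t‖ ≤ C := by
  open NonlocalSystem in
  have hS : ∀ x, x ∉ Icc a (a + δ) → u₀.rep x = 0 := H1.rep_eq_zero_of_ae hsupp
  have hV : ∀ᵐ x, x ∈ Icc a (a + δ) → v₀.rep x ≤ -3 := by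
    filter_upwards [hv₀, v₀.fn_ae_eq] with x hx hx' hxI
    rw [← hx']
    exact hx hxI
  -- The summands `√δ`, `δ` and `1` in `A` account for the sup norm of `u`, its `L²` norm and the
  -- norm of `u_x`. `B` adds the bounds for `v` and `v_x`.
  set A := (√δ + δ + 1) * ‖u₀.dx‖ with hA
  set B := ‖v₀.fn‖ + ‖v₀.dx‖ + (δ * √δ + √δ) * ‖u₀.dx‖ ^ 2 with hB
  have hA0 : 0 ≤ A := by positivity
  have hB0 : 0 ≤ B := by positivity
  have hbound : ∀ T ≥ 0, ∀ γ : ℝ → H1 × H1, γ 0 = (u₀, v₀) →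
      (∀ t ∈ Icc 0 T, HasDerivWithinAt γ (vectorField (γ t)) (Icc 0 T) t) →
      ∀ t ∈ Icc 0 T, (∀ x, |(γ t).1.rep x| ≤ A * Real.exp (-3 * t)) ∧
        ‖(γ t).1‖ ≤ A * Real.exp (-3 * t) ∧ ‖(γ t).2‖ ≤ B := by
    intro T hT γ h0 hγ t ht
    obtain ⟨h1, h2, h3, h4⟩ := apriori_estimate (a := a) hδ hT hγ (by rwa [h0]) (by rwa [h0])
      (by rwa [h0]) t ht
    rw [h0] at h2 h3 h4
    -- The estimate gives the rate `e^{-4t}`, more than the `e^{-3t}` required.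
    have hexp : ‖(γ t).1.dx‖ ≤ ‖u₀.dx‖ * Real.exp (-3 * t) :=
      h2.trans (mul_le_mul_of_nonneg_left (Real.exp_le_exp.2 (by linarith [ht.1])) (norm_nonneg _))
    have hA' : A * Real.exp (-3 * t) = √δ * (‖u₀.dx‖ * Real.exp (-3 * t)) +
        δ * (‖u₀.dx‖ * Real.exp (-3 * t)) + ‖u₀.dx‖ * Real.exp (-3 * t) := by
      rw [hA]; ring
    have hp1 := mul_le_mul_of_nonneg_left hexp (Real.sqrt_nonneg δ)
    have hp2 := mul_le_mul_of_nonneg_left hexp hδ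
    have hE : 0 ≤ ‖u₀.dx‖ * Real.exp (-3 * t) := by positivity
    have hE1 := mul_nonneg (Real.sqrt_nonneg δ) hE
    have hE2 := mul_nonneg hδ hE
    refine ⟨fun x => ?_, ?_, ?_⟩
    · linarith [H1.abs_rep_le_of_support h1 x]
    · linarith [(γ t).1.norm_le, H1.norm_fn_le_of_support hδ h1]
    · simp only at h3 h4
      linarith [(γ t).2.norm_le]
  obtain ⟨γ, h0, hγ⟩ := exists_solution_Ici_of_apriori exists_lipschitzOnWith_vectorField
    (x₀ := (u₀, v₀)) (C := max A B) fun T hT γ h0 hγ t ht => by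
      obtain ⟨-, h2, h3⟩ := hbound T hT γ h0 hγ t ht
      refine max_le_max (h2.trans (mul_le_of_le_one_right hA0 ?_)) h3
      exact Real.exp_le_one_iff.2 (by linarith [ht.1])
  have hest : ∀ t ≥ 0, (∀ x, |(γ t).1.rep x| ≤ A * Real.exp (-3 * t)) ∧
      ‖(γ t).1‖ ≤ A * Real.exp (-3 * t) ∧ ‖(γ t).2‖ ≤ B := fun t ht =>
    hbound t ht γ h0 (fun s hs => (hγ s hs.1).mono Icc_subset_Ici_self) t (right_mem_Icc.2 ht)
  have hbig : ∀ t ≥ 0, A * Real.exp (-3 * t) ≤ (A + B) * Real.exp (-3 * t) := fun t _ =>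
    mul_le_mul_of_nonneg_right (by linarith) (Real.exp_pos _).le
  refine ⟨fun t => (γ t).1, fun t => (γ t).2,
    isSolutionOn_of_hasDerivWithinAt (uniqueDiffOn_Ici 0) h0 hγ, ?_, ⟨A + B, fun t ht => ?_⟩,
    A + B, fun t ht => ?_⟩
  · intro T _ u' v' hsol t ht
    have hsub : Icc 0 t ⊆ Ico 0 T := fun s hs => ⟨hs.1, hs.2.trans_lt ht.2⟩
    have h := eqOn_Icc_of_locallyLipschitz exists_lipschitzOnWith_vectorField
      (fun s hs => (hsol.hasDerivWithinAt s (hsub hs)).mono hsub)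
      (fun s hs => (hγ s hs.1).mono Icc_subset_Ici_self)
      (by rw [h0, hsol.initial_u, hsol.initial_v]) (right_mem_Icc.2 ht.1)
    exact Prod.ext_iff.1 h
  · obtain ⟨-, h2, h3⟩ := hest t ht
    have h4 := mul_le_of_le_one_right hA0
      (Real.exp_le_one_iff.2 (show -3 * t ≤ 0 by linarith))
    exact ⟨by linarith, by linarith⟩
  · obtain ⟨h1, h2, h3⟩ := hest t ht
    refine ⟨?_, h2.trans (hbig t ht), by linarith⟩
    rw [eLpNorm_exponent_top]
    refine eLpNormEssSup_le_of_ae_bound ?_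
    filter_upwards [(γ t).1.fn_ae_eq] with x hx
    rw [hx]
    exact (h1 x).trans (hbig t ht)
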